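/- Let $c\ge 1$ and let $\nu$ be a probability law on real $c\times c$ matrices (a point mass if the matrix is deterministic); $A=(A_{i,j})$ denotes a matrix of law $\nu$, the navigation matrix. The continuum Pólya-like random walk $X(t)=(X_1(t),\dots,X_c(t))$, $t\ge 0$, is the pure-jump process in $\mathbb{R}^c$ that behaves as follows. It starts at a (deterministic or random) position $X(0)$. Whenever its position is $x$, the waiting time until the next renewal is exponential with rate $\sum_j x_j$, and the renewal is of type $i$ with probability $x_i/\sum_j x_j$. At a renewal of type $i$, row $i$ of a fresh copy of the navigation matrix is added to the position. Given the history up to the preceding renewal, the waiting time, the type and this copy of the matrix are independent, and the copy has law $\nu$. The walk is assumed tenable (almost surely all coordinates stay nonnegative and the origin is avoided), and almost surely only finitely many renewals occur in each bounded time interval. Put $$\phi(t,u)=\mathbb{E}\Big[\exp\Big(\sum_{j} u_jX_j(t)\Big)\Big],\qquad \psi_i(u)=\mathbb{E}\Big[\exp\Big(\sum_{j} u_jA_{i,j}\Big)\Big].$$ Let $t\ge 0$ and $u\in\mathbb{R}^c$ be such that $\phi$ is finite on a neighbourhood of $(t,u)$ in $[0,\infty)\times\mathbb{R}^c$. Then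 the partial derivatives $\partial\phi/\partial t$ (right derivative if $t=0$) and $\partial\phi/\partial u_i$, $1\le i\le c$, exist at $(t,u)$; $\psi_i(u)$ is finite for every $i$ with $\partial\phi/\partial u_i(t,u)\ne 0$; and $$\frac{\partial\phi}{\partial t}(t,u)+\sum_{i=1}^{c}\bigl(1-\psi_i(u)\bigr)\frac{\partial\phi}{\partial u_i}(t,u)=0,$$ where terms with $\partial\phi/\partial u_i(t,u)=0$ are read as $0$. -/

import Mathlib

open MeasureTheory Filter Topology

noncomputable section

namespace PolyaWalk

/-- `n`-th renewal time, the sum of the first `n` waiting times. -/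
def renewalTime {Ω : Type*} (W : ℕ → Ω → ℝ) (n : ℕ) (ω : Ω) : ℝ :=
  ∑ k ∈ Finset.range n, W k ω

/-- `X` is the continuum Pólya-like walk in `c` dimensions whose navigation matrix has law `ν`
(a Dirac mass when the matrix is deterministic), described by its renewals:
`Y n` is the position after `n` renewals, `W n` the waiting time from the `n`-th renewal to the
next one, `I n` the type (coordinate) of that next renewal, and `A n` the copy of the navigation
matrix used at it. `ℱ n` contains the history up to and including the `n`-th renewal. -/
structure IsWalkWith {Ω : Type*} [mΩ : MeasurableSpace Ω] (P : Measure Ω) {c : ℕ}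
    (ν : Measure (Fin c → Fin c → ℝ)) (X : ℝ → Ω → Fin c → ℝ)
    (ℱ : Filtration ℕ mΩ) (Y : ℕ → Ω → Fin c → ℝ) (W : ℕ → Ω → ℝ) (I : ℕ → Ω → Fin c)
    (A : ℕ → Ω → Fin c → Fin c → ℝ) : Prop where
  measurable_pos : ∀ n, Measurable[ℱ n] (Y n)
  measurable_wait : ∀ n, Measurable[ℱ (n + 1)] (W n)
  measurable_type : ∀ n, Measurable[ℱ (n + 1)] (I n)
  measurable_mat : ∀ n, Measurable[ℱ (n + 1)] (A n)
  /-- Tenability: coordinates stay nonnegative and the origin is avoided. -/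
  tenable : ∀ᵐ ω ∂P, ∀ n, (∀ i, 0 ≤ Y n ω i) ∧ Y n ω ≠ 0
  /-- Given the history up to the `n`-th renewal, the waiting time is exponential with rate
  `∑ j, Y n j`, the type is `i` with probability `Y n i / ∑ j, Y n j`, the navigation matrix has
  law `ν`, and these three are conditionally independent. -/
  step_law : ∀ (n : ℕ) (H : Set Ω), MeasurableSet[ℱ n] H → ∀ s : ℝ, 0 ≤ s → ∀ i : Fin c,
    ∀ B : Set (Fin c → Fin c → ℝ), MeasurableSet B →
      P (H ∩ {ω | s < W n ω ∧ I n ω = i ∧ A n ω ∈ B}) =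
        ∫⁻ ω in H, ENNReal.ofReal
          (Real.exp (-s * ∑ j, Y n ω j) * (Y n ω i / ∑ j, Y n ω j)) * ν B ∂P
  /-- At a renewal of type `i`, row `i` of the navigation matrix is added to the position. -/
  step_eq : ∀ᵐ ω ∂P, ∀ n, ∀ j, Y (n + 1) ω j = Y n ω j + A n ω (I n ω) j
  /-- Only finitely many renewals occur in a bounded time interval, so that the position is
  defined at all times. -/
  nonexplosive : ∀ᵐ ω ∂P, Tendsto (fun n => renewalTime W n ω) atTop atTop
  /-- The walk stays put between renewals. -/
  pos_eq : ∀ᵐ ω ∂P, ∀ (n : ℕ) (t : ℝ),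
    renewalTime W n ω ≤ t → t < renewalTime W (n + 1) ω → X t ω = Y n ω

/-- `X` (at times `t ≥ 0`) is a continuum Pólya-like walk with navigation matrix of law `ν`. -/
def IsWalk {Ω : Type*} [mΩ : MeasurableSpace Ω] (P : Measure Ω) {c : ℕ}
    (ν : Measure (Fin c → Fin c → ℝ)) (X : ℝ → Ω → Fin c → ℝ) : Prop :=
  ∃ (ℱ : Filtration ℕ mΩ) (Y : ℕ → Ω → Fin c → ℝ) (W : ℕ → Ω → ℝ) (I : ℕ → Ω → Fin c)
    (A : ℕ → Ω → Fin c → Fin c → ℝ), IsWalkWith P ν X ℱ Y W I A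

/-- Joint moment generating function `φ(t, u)` of the position at time `t`. -/
def phi {Ω : Type*} [MeasurableSpace Ω] (P : Measure Ω) {c : ℕ} (X : ℝ → Ω → Fin c → ℝ)
    (t : ℝ) (u : Fin c → ℝ) : ℝ :=
  ∫ ω, Real.exp (∑ j, u j * X t ω j) ∂P

/-- Joint moment generating function `ψ_i(u)` of row `i` of the navigation matrix. -/
def psi {c : ℕ} (ν : Measure (Fin c → Fin c → ℝ)) (i : Fin c) (u : Fin c → ℝ) : ℝ :=
  ∫ M, Real.exp (∑ j, u j * M i j) ∂ν

end PolyaWalk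

end

/-! The differential equation is solved along its characteristic lines `s ↦ (s, u + (s - t) • 1)`.
On such a line the weight `exp (s * rate y)` cancels the dependence on `s` of the probability `exp
(-(s - T) * rate y)` that a walk which reached `y` at time `T` has not yet left. What remains
changes only through jumps. Conditioning on the step law and applying Tonelli gives the Duhamel
identity `lintegral_exp_rate_eq`: along the line, the moment generating function is a constant plus
the time integral of `∑ i, E[X_i exp (u·X)] * ψ_i`. It holds in `ℝ≥0∞` without any integrability
assumption.

Finiteness near `(t, u)` then gives the regularity. Because the integrand is nonnegative, weighted
moment generating functions increase along characteristic lines; because positions are nonnegative,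
they also increase in `u`. Sandwiching between nearby lines gives joint continuity
(`tendsto_weightedMgf`). If coordinate `i` charges the walk while `ψ_i` is infinite on a stretch of
the line, the Duhamel integral diverges, so `ψ_i` is finite around `u` (`rowMgf_shift_ne_top`). The
integrand is thus continuous at `t`, and `φ` is differentiable along the line.

Convexity of `φ` in `u` supplies tangent inequalities, which give both the partial derivatives in
`u` and the derivative of `φ(s, u + (s - t) • 1) - φ(s, u)`. Subtracting the latter from the
derivative along the line gives the time derivative and the equation. -/

noncomputable section

namespace PolyaWalk

open Set ENNReal

/-! ### Total rate, measurability and positivity of the waiting times. -/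

/-- Sum of the coordinates of a position: the total renewal rate. -/
def rate {c : ℕ} (y : Fin c → ℝ) : ℝ := ∑ j, y j

@[fun_prop]
lemma measurable_rate {c : ℕ} : Measurable (rate (c := c)) := by
  unfold rate; fun_prop

lemma rate_pos {c : ℕ} {y : Fin c → ℝ} (h : ∀ i, 0 ≤ y i) (h0 : y ≠ 0) : 0 < rate y := by
  obtain ⟨i, hi⟩ := Function.ne_iff.mp h0
  exact Finset.sum_pos' (fun i _ => h i) ⟨i, Finset.mem_univ i, lt_of_le_of_ne (h i) (Ne.symm hi)⟩

/-- Passes from the survival form of `step_law` to a density in the waiting time. -/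
lemma lintegral_Ioi_exp_neg_mul {a S : ℝ} (hS : 0 < S) (ha : 0 ≤ a) (s : ℝ) :
    ∫⁻ w in Ioi s, ENNReal.ofReal (Real.exp (-w * S) * a) =
      ENNReal.ofReal (Real.exp (-s * S) * (a / S)) := by
  have h1 : ∀ w : ℝ, Real.exp (-w * S) = Real.exp (-S * w) := fun w => by ring_nf
  simp_rw [h1]
  rw [← ofReal_integral_eq_lintegral_ofReal]
  · rw [integral_mul_const, integral_exp_mul_Ioi (by linarith)]
    congr 1
    field_simp
  · exact (integrableOn_exp_mul_Ioi (by linarith) s).mul_const a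
  · exact ae_of_all _ fun w => by positivity

variable {Ω : Type*} [mΩ : MeasurableSpace Ω] {P : Measure Ω} {c : ℕ}
  {ν : Measure (Fin c → Fin c → ℝ)} {X : ℝ → Ω → Fin c → ℝ}
  {ℱ : Filtration ℕ mΩ} {Y : ℕ → Ω → Fin c → ℝ} {W : ℕ → Ω → ℝ} {I : ℕ → Ω → Fin c}
  {A : ℕ → Ω → Fin c → Fin c → ℝ}

namespace IsWalkWith

lemma measurable_pos' (h : IsWalkWith P ν X ℱ Y W I A) (n : ℕ) : Measurable (Y n) :=
  (h.measurable_pos n).mono (ℱ.le n) le_rfl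

lemma measurable_wait' (h : IsWalkWith P ν X ℱ Y W I A) (n : ℕ) : Measurable (W n) :=
  (h.measurable_wait n).mono (ℱ.le _) le_rfl

lemma measurable_type' (h : IsWalkWith P ν X ℱ Y W I A) (n : ℕ) : Measurable (I n) :=
  (h.measurable_type n).mono (ℱ.le _) le_rfl

lemma measurable_mat' (h : IsWalkWith P ν X ℱ Y W I A) (n : ℕ) : Measurable (A n) :=
  (h.measurable_mat n).mono (ℱ.le _) le_rfl

lemma measurable_renewalTime (h : IsWalkWith P ν X ℱ Y W I A) (n : ℕ) :
    Measurable[ℱ n] (renewalTime W n) := by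
  unfold renewalTime
  refine Finset.measurable_fun_sum _ fun k hk => ?_
  exact (h.measurable_wait k).mono (ℱ.mono (Finset.mem_range.mp hk)) le_rfl

lemma measurable_renewalTime' (h : IsWalkWith P ν X ℱ Y W I A) (n : ℕ) :
    Measurable (renewalTime W n) :=
  (h.measurable_renewalTime n).mono (ℱ.le _) le_rfl

lemma rate_pos_ae (h : IsWalkWith P ν X ℱ Y W I A) :
    ∀ᵐ ω ∂P, ∀ n, (∀ i, 0 ≤ Y n ω i) ∧ 0 < rate (Y n ω) := by
  filter_upwards [h.tenable] with ω hω n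
  exact ⟨(hω n).1, rate_pos (hω n).1 (hω n).2⟩

variable [IsProbabilityMeasure P] [IsProbabilityMeasure ν]

/-- At `s = 0` the step law gives the type probabilities, which sum to one because the total rate is
positive almost surely. -/
lemma wait_pos_ae (h : IsWalkWith P ν X ℱ Y W I A) : ∀ᵐ ω ∂P, ∀ n, 0 < W n ω := by
  rw [ae_all_iff]
  intro n
  have hm : MeasurableSet {ω | 0 < W n ω} := measurableSet_lt measurable_const (h.measurable_wait' n)
  change P {ω | 0 < W n ω}ᶜ = 0
  rw [prob_compl_eq_zero_iff hm]
  have hI : ∀ i, MeasurableSet {ω | I n ω = i} := fun i =>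
    h.measurable_type' n (measurableSet_singleton i)
  calc P {ω | 0 < W n ω} = ∑ i, P ({ω | 0 < W n ω} ∩ {ω | I n ω = i}) := by
        rw [← measure_biUnion_finset (fun i _ j _ hij => by
          refine disjoint_left.mpr fun ω h1 h2 => hij ?_
          exact h1.2.symm.trans h2.2) (fun i _ => hm.inter (hI i))]
        congr 1
        ext ω
        simp
    _ = ∑ i, ∫⁻ ω, ENNReal.ofReal (Y n ω i / rate (Y n ω)) ∂P := by
        refine Finset.sum_congr rfl fun i _ => ?_
        have := h.step_law n univ MeasurableSet.univ 0 le_rfl i univ MeasurableSet.univ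
        simp only [univ_inter, mem_univ, and_true, measure_univ, mul_one, neg_zero, zero_mul,
          Real.exp_zero, one_mul, Measure.restrict_univ] at this
        exact this
    _ = 1 := by
        have hY := h.measurable_pos' n
        rw [← lintegral_finsetSum _ fun i _ => by fun_prop]
        rw [← measure_univ (μ := P), ← lintegral_one]
        refine lintegral_congr_ae ?_
        filter_upwards [h.rate_pos_ae] with ω hω
        rw [← ENNReal.ofReal_sum_of_nonneg fun i _ => div_nonneg ((hω n).1 i) (hω n).2.le,
          ← Finset.sum_div]
        change ENNReal.ofReal (rate (Y n ω) / rate (Y n ω)) = 1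
        rw [div_self (hω n).2.ne', ENNReal.ofReal_one]

/-- Density of the joint law of a waiting time and a renewal of type `i`, given the position. -/
def stepDensity (i : Fin c) (y : Fin c → ℝ) (w : ℝ) : ℝ≥0∞ :=
  ENNReal.ofReal (Real.exp (-w * rate y) * y i)

lemma measurable_stepDensity (i : Fin c) :
    Measurable (fun p : (Fin c → ℝ) × ℝ => stepDensity i p.1 p.2) := by
  unfold stepDensity; fun_prop

end IsWalkWith
end PolyaWalk

end

/-! ### Joint law of waiting time, type and matrix given the past. -/

noncomputable section

namespace PolyaWalk

open Set ENNReal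

/-- The step law prescribes only the tails at `s ≥ 0`; the absence of mass on `Iic 0` supplies the
remaining tails, and half-lines form a generating π-system. -/
lemma measure_ext_of_Ioi_nonneg {μ₁ μ₂ : Measure ℝ} [IsFiniteMeasure μ₁]
    (h₁ : μ₁ (Iic 0) = 0) (h₂ : μ₂ (Iic 0) = 0)
    (h : ∀ s : ℝ, 0 ≤ s → μ₁ (Ioi s) = μ₂ (Ioi s)) : μ₁ = μ₂ := by
  have key : ∀ (μ : Measure ℝ), μ (Iic 0) = 0 → ∀ E, Ioi (0 : ℝ) ⊆ E → μ E = μ (Ioi 0) := by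
    intro μ hμ E hE
    refine le_antisymm ?_ (measure_mono hE)
    calc μ E ≤ μ (Iic 0 ∪ Ioi 0) := measure_mono (by simp)
      _ ≤ μ (Iic 0) + μ (Ioi 0) := measure_union_le _ _
      _ = μ (Ioi 0) := by rw [hμ, zero_add]
  refine ext_of_generate_finite (range Ioi) ?_ isPiSystem_Ioi ?_ ?_
  · rw [← borel_eq_generateFrom_Ioi]; exact BorelSpace.measurable_eq
  · rintro _ ⟨s, rfl⟩
    rcases le_total 0 s with hs | hs
    · exact h s hs
    · rw [key μ₁ h₁ _ (Ioi_subset_Ioi hs), key μ₂ h₂ _ (Ioi_subset_Ioi hs), h 0 le_rfl]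
  · rw [key μ₁ h₁ _ (subset_univ _), key μ₂ h₂ _ (subset_univ _), h 0 le_rfl]

variable {Ω : Type*} [mΩ : MeasurableSpace Ω] {P : Measure Ω} {c : ℕ}
  {ν : Measure (Fin c → Fin c → ℝ)} {X : ℝ → Ω → Fin c → ℝ}
  {ℱ : Filtration ℕ mΩ} {Y : ℕ → Ω → Fin c → ℝ} {W : ℕ → Ω → ℝ} {I : ℕ → Ω → Fin c}
  {A : ℕ → Ω → Fin c → Fin c → ℝ}

namespace IsWalkWith

variable [IsProbabilityMeasure P] [IsProbabilityMeasure ν]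

/-- For fixed `H`, `i` and `B`, both sides are measures in `E`. Their tails agree by `step_law`, and
neither charges `Iic 0`. -/
lemma step_law_wait (h : IsWalkWith P ν X ℱ Y W I A) (n : ℕ) (i : Fin c)
    {H : Set (ℝ × (Fin c → ℝ))} (hH : MeasurableSet H) {E : Set ℝ} (hE : MeasurableSet E)
    {B : Set (Fin c → Fin c → ℝ)} (hB : MeasurableSet B) :
    P {ω | (renewalTime W n ω, Y n ω) ∈ H ∧ W n ω ∈ E ∧ I n ω = i ∧ A n ω ∈ B} =
      (∫⁻ ω in {ω | (renewalTime W n ω, Y n ω) ∈ H},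
        (∫⁻ w in E ∩ Ioi 0, stepDensity i (Y n ω) w) ∂P) * ν B := by
  have hT := h.measurable_renewalTime' n
  have hY := h.measurable_pos' n
  have hW := h.measurable_wait' n
  have hZF : MeasurableSet[ℱ n] {ω | (renewalTime W n ω, Y n ω) ∈ H} :=
    (Measurable.prodMk (h.measurable_renewalTime n) (h.measurable_pos n)) hH
  have hZ : MeasurableSet {ω | (renewalTime W n ω, Y n ω) ∈ H} := (ℱ.le n) _ hZF
  have hI : MeasurableSet {ω | I n ω = i} := h.measurable_type' n (measurableSet_singleton i)
  have hA : MeasurableSet {ω | A n ω ∈ B} := h.measurable_mat' n hB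
  set S : Set Ω := {ω | (renewalTime W n ω, Y n ω) ∈ H} with hS
  let μ₁ : Measure ℝ := (P.restrict (S ∩ ({ω | I n ω = i} ∩ {ω | A n ω ∈ B}))).map (W n)
  let μ₂ : Measure ℝ := ν B • (((P.restrict S).prod (volume.restrict (Ioi (0 : ℝ)))).withDensity
    (fun p => stepDensity i (Y n p.1) p.2)).map Prod.snd
  have hd : Measurable (fun p : Ω × ℝ => stepDensity i (Y n p.1) p.2) :=
    (measurable_stepDensity i).comp (by fun_prop : Measurable fun p : Ω × ℝ => (Y n p.1, p.2))
  have e₁ : ∀ E, MeasurableSet E →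
      μ₁ E = P {ω | ω ∈ S ∧ W n ω ∈ E ∧ I n ω = i ∧ A n ω ∈ B} := by
    intro E hE
    rw [Measure.map_apply hW hE, Measure.restrict_apply (hW hE)]
    congr 1
    ext ω
    simp only [mem_inter_iff, mem_preimage, mem_ofPred_eq]
    tauto
  have e₂ : ∀ E, MeasurableSet E →
      μ₂ E = (∫⁻ ω in S, (∫⁻ w in E ∩ Ioi 0, stepDensity i (Y n ω) w) ∂P) * ν B := by
    intro E hE
    simp only [μ₂, Measure.smul_apply, smul_eq_mul]
    rw [mul_comm, Measure.map_apply measurable_snd hE, withDensity_apply _ (measurable_snd hE),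
      ← univ_prod, ← Measure.prod_restrict, Measure.restrict_univ,
      lintegral_prod _ hd.aemeasurable, Measure.restrict_restrict hE]
  have main : μ₁ = μ₂ := by
    refine measure_ext_of_Ioi_nonneg ?_ ?_ ?_
    · rw [e₁ _ measurableSet_Iic]
      refine measure_mono_null ?_ h.wait_pos_ae
      rintro ω hω hpos
      exact absurd (hpos n) (not_lt.mpr hω.2.1)
    · rw [e₂ _ measurableSet_Iic]
      simp [Iic_inter_Ioi]
    · intro s hs
      rw [e₁ _ measurableSet_Ioi, e₂ _ measurableSet_Ioi]
      have h1 := h.step_law n S hZF s hs i B hB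
      rw [lintegral_mul_const _ (by fun_prop)] at h1
      refine Eq.trans (congrArg P ?_) (h1.trans ?_)
      · ext ω
        simp only [mem_inter_iff, mem_ofPred_eq, mem_Ioi]
      · congr 1
        refine lintegral_congr_ae (ae_restrict_of_ae ?_)
        filter_upwards [h.rate_pos_ae] with ω hω
        rw [inter_eq_left.mpr (Ioi_subset_Ioi hs)]
        exact (lintegral_Ioi_exp_neg_mul (hω n).2 ((hω n).1 i) s).symm
  have := e₁ E hE
  rw [main, e₂ E hE] at this
  exact this.symm

/-- Integrated form of the step law: the conditional law of the waiting time, the type and the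
navigation matrix given the renewal time and the position. -/
lemma lintegral_step (h : IsWalkWith P ν X ℱ Y W I A) (n : ℕ) (i : Fin c)
    {g : ((ℝ × (Fin c → ℝ)) × ℝ) × (Fin c → Fin c → ℝ) → ℝ≥0∞} (hg : Measurable g) :
    ∫⁻ ω in {ω | I n ω = i}, g (((renewalTime W n ω, Y n ω), W n ω), A n ω) ∂P =
      ∫⁻ ω, (∫⁻ w in Ioi 0, stepDensity i (Y n ω) w *
        ∫⁻ M, g (((renewalTime W n ω, Y n ω), w), M) ∂ν) ∂P := by
  have hT := h.measurable_renewalTime' n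
  have hY := h.measurable_pos' n
  have hW := h.measurable_wait' n
  have hA := h.measurable_mat' n
  have hI : MeasurableSet {ω | I n ω = i} := h.measurable_type' n (measurableSet_singleton i)
  have hZ : Measurable fun ω => (renewalTime W n ω, Y n ω) := by fun_prop
  let lam := P.map fun ω => (renewalTime W n ω, Y n ω)
  have : IsProbabilityMeasure lam := Measure.isProbabilityMeasure_map hZ.aemeasurable
  let d : ((ℝ × (Fin c → ℝ)) × ℝ) × (Fin c → Fin c → ℝ) → ℝ≥0∞ :=
    fun p => stepDensity i p.1.1.2 p.1.2
  have hd : Measurable d := (measurable_stepDensity i).comp (by fun_prop :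
    Measurable fun p : ((ℝ × (Fin c → ℝ)) × ℝ) × (Fin c → Fin c → ℝ) => (p.1.1.2, p.1.2))
  have hd' : Measurable (fun p : (ℝ × (Fin c → ℝ)) × ℝ => stepDensity i p.1.2 p.2) :=
    (measurable_stepDensity i).comp (by fun_prop :
      Measurable fun p : (ℝ × (Fin c → ℝ)) × ℝ => (p.1.2, p.2))
  let ρ : Measure (((ℝ × (Fin c → ℝ)) × ℝ) × (Fin c → Fin c → ℝ)) :=
    ((lam.prod (volume.restrict (Ioi 0))).prod ν).withDensity d
  have hmeas : Measurable fun ω => (((renewalTime W n ω, Y n ω), W n ω), A n ω) := by fun_prop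
  have main : (P.restrict {ω | I n ω = i}).map
      (fun ω => (((renewalTime W n ω, Y n ω), W n ω), A n ω)) = ρ := by
    -- Finite measures on a triple product are determined by boxes, where `step_law_wait` applies.
    refine Measure.ext_prod₃' fun {H E B} hH hE hB => ?_
    rw [Measure.map_apply hmeas ((hH.prod hE).prod hB),
      Measure.restrict_apply (hmeas ((hH.prod hE).prod hB)),
      withDensity_apply _ ((hH.prod hE).prod hB), ← Measure.prod_restrict, ← Measure.prod_restrict,
      lintegral_prod _ hd.aemeasurable, Measure.restrict_restrict hE]
    simp only [d, lintegral_const, Measure.restrict_apply_univ]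
    rw [lintegral_mul_const _ hd', lintegral_prod _ hd'.aemeasurable,
      setLIntegral_map hH (hd'.lintegral_prod_right' ) hZ]
    refine Eq.trans (congrArg P ?_) (h.step_law_wait n i hH hE hB)
    ext ω
    simp only [mem_inter_iff, mem_preimage, mem_prod, mem_ofPred_eq]
    tauto
  have hgd : Measurable fun p : (ℝ × (Fin c → ℝ)) × ℝ =>
      stepDensity i p.1.2 p.2 * ∫⁻ M, g (p, M) ∂ν := hd'.mul hg.lintegral_prod_right'
  calc ∫⁻ ω in {ω | I n ω = i}, g (((renewalTime W n ω, Y n ω), W n ω), A n ω) ∂P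
      = ∫⁻ p, g p ∂ρ := by rw [← main, lintegral_map hg hmeas]
    _ = ∫⁻ p, stepDensity i p.1.2 p.2 * ∫⁻ M, g (p, M) ∂ν ∂(lam.prod (volume.restrict (Ioi 0))) := by
        rw [lintegral_withDensity_eq_lintegral_mul _ hd hg,
          lintegral_prod _ (hd.mul hg).aemeasurable]
        refine lintegral_congr fun p => ?_
        simp only [Pi.mul_apply, d]
        rw [lintegral_const_mul]
        exact hg.comp measurable_prodMk_left
    _ = _ := by
        rw [lintegral_prod _ hgd.aemeasurable, lintegral_map hgd.lintegral_prod_right' hZ]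

end IsWalkWith
end PolyaWalk

end

/-! ### Decomposition of the position at a fixed time over renewal intervals. -/

noncomputable section

namespace PolyaWalk

open Set ENNReal

lemma exists_le_lt_succ_of_tendsto {T : ℕ → ℝ} (hT : Tendsto T atTop atTop) {r : ℝ}
    (h0 : T 0 ≤ r) : ∃ n, T n ≤ r ∧ r < T (n + 1) := by
  classical
  have hex : ∃ n, r < T n := (hT.eventually_gt_atTop r).exists
  have hne : Nat.find hex ≠ 0 := fun h => by
    have := Nat.find_spec hex
    rw [h] at this
    linarith
  obtain ⟨m, hm⟩ := Nat.exists_eq_succ_of_ne_zero hne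
  refine ⟨m, not_lt.mp (Nat.find_min hex (by omega)), ?_⟩
  have := Nat.find_spec hex
  rwa [hm] at this

lemma renewalTime_succ {Ω : Type*} {W : ℕ → Ω → ℝ} (n : ℕ) (ω : Ω) :
    renewalTime W (n + 1) ω = renewalTime W n ω + W n ω :=
  Finset.sum_range_succ _ _

/-- Exponentially weighted mean effect of a jump: the sum over the types `i` of the rate `y i`
times the mean of `f (z) * exp (r * rate z)` at the position `z` after a jump of type `i`. -/
def gain {c : ℕ} (ν : Measure (Fin c → Fin c → ℝ)) (f : (Fin c → ℝ) → ℝ≥0∞) (r : ℝ)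
    (y : Fin c → ℝ) : ℝ≥0∞ :=
  ∑ i, ENNReal.ofReal (y i) *
    ∫⁻ M, f (y + M i) * ENNReal.ofReal (Real.exp (r * rate (y + M i))) ∂ν

lemma measurable_gain {c : ℕ} (ν : Measure (Fin c → Fin c → ℝ)) [SFinite ν]
    {f : (Fin c → ℝ) → ℝ≥0∞} (hf : Measurable f) :
    Measurable fun p : ℝ × (Fin c → ℝ) => gain ν f p.1 p.2 := by
  unfold gain
  refine Finset.measurable_fun_sum _ fun i _ => Measurable.mul (by fun_prop) ?_
  exact Measurable.lintegral_prod_right' (ν := ν) (f := fun p : (ℝ × (Fin c → ℝ)) × _ =>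
    f (p.1.2 + p.2 i) * ENNReal.ofReal (Real.exp (p.1.1 * rate (p.1.2 + p.2 i)))) (by fun_prop)

variable {Ω : Type*} [mΩ : MeasurableSpace Ω] {P : Measure Ω} {c : ℕ}
  {ν : Measure (Fin c → Fin c → ℝ)} {X : ℝ → Ω → Fin c → ℝ}
  {ℱ : Filtration ℕ mΩ} {Y : ℕ → Ω → Fin c → ℝ} {W : ℕ → Ω → ℝ} {I : ℕ → Ω → Fin c}
  {A : ℕ → Ω → Fin c → Fin c → ℝ}

namespace IsWalkWith

lemma measurable_renewal_interval_ite (h : IsWalkWith P ν X ℱ Y W I A) (r : ℝ) (n : ℕ)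
    {g : (Fin c → ℝ) → ℝ≥0∞} (hg : Measurable g) : Measurable fun ω =>
      if renewalTime W n ω ≤ r ∧ r < renewalTime W (n + 1) ω then g (Y n ω) else 0 := by
  have hY := h.measurable_pos' n
  have hT := h.measurable_renewalTime'
  refine Measurable.ite ?_ (by fun_prop) measurable_const
  exact (measurableSet_le (hT n) (by fun_prop)).inter (measurableSet_lt (by fun_prop) (hT _))

variable [IsProbabilityMeasure P] [IsProbabilityMeasure ν]


lemma lintegral_step_sum (h : IsWalkWith P ν X ℱ Y W I A) (n : ℕ)
    {g : Fin c → ((ℝ × (Fin c → ℝ)) × ℝ) × (Fin c → Fin c → ℝ) → ℝ≥0∞}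
    (hg : ∀ i, Measurable (g i)) :
    ∫⁻ ω, g (I n ω) (((renewalTime W n ω, Y n ω), W n ω), A n ω) ∂P =
      ∑ i, ∫⁻ ω, (∫⁻ w in Ioi 0, stepDensity i (Y n ω) w *
        ∫⁻ M, g i (((renewalTime W n ω, Y n ω), w), M) ∂ν) ∂P := by
  have hI : ∀ i, MeasurableSet {ω | I n ω = i} := fun i =>
    h.measurable_type' n (measurableSet_singleton i)
  have hU : (⋃ i ∈ (Finset.univ : Finset (Fin c)), {ω | I n ω = i}) = univ := by
    ext ω; simp
  rw [← Measure.restrict_univ (μ := P), ← hU, lintegral_biUnion_finset]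
  · refine Finset.sum_congr rfl fun i _ => ?_
    rw [hU, Measure.restrict_univ, ← h.lintegral_step n i (hg i)]
    exact setLIntegral_congr_fun (hI i) fun ω (hω : I n ω = i) => by simp only [hω]
  · intro i _ j _ hij
    exact disjoint_left.mpr fun ω (h1 : _ = _) (h2 : _ = _) => hij (h1.symm.trans h2)
  · exact fun i _ => hI i

lemma strictMono_renewalTime_ae (h : IsWalkWith P ν X ℱ Y W I A) :
    ∀ᵐ ω ∂P, StrictMono fun n => renewalTime W n ω := by
  filter_upwards [h.wait_pos_ae] with ω hω
  refine strictMono_nat_of_lt_succ fun n => ?_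
  rw [renewalTime_succ]
  linarith [hω n]

/-- At each time the walk sits at exactly one of the positions `Y n`. -/
lemma exists_renewal_interval_ae (h : IsWalkWith P ν X ℱ Y W I A) :
    ∀ᵐ ω ∂P, ∀ r : ℝ, 0 ≤ r → ∃ n, X r ω = Y n ω ∧
      ∀ m, (renewalTime W m ω ≤ r ∧ r < renewalTime W (m + 1) ω) ↔ m = n := by
  filter_upwards [h.strictMono_renewalTime_ae, h.nonexplosive, h.pos_eq] with ω hm hT hX r hr
  obtain ⟨n, h1, h2⟩ := exists_le_lt_succ_of_tendsto hT (r := r) (by simpa [renewalTime] using hr)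
  refine ⟨n, hX n r h1 h2, fun m => ⟨fun ⟨h3, h4⟩ => ?_, fun e => e ▸ ⟨h1, h2⟩⟩⟩
  have a := hm.lt_iff_lt.mp (h3.trans_lt h2)
  have b := hm.lt_iff_lt.mp (h1.trans_lt h4)
  omega

/-- Integrates out the waiting time: given the past, no renewal occurs during the remaining `r -
renewalTime W n` with the exponential probability, once the type probabilities have been summed to
one. -/
lemma lintegral_renewal_interval (h : IsWalkWith P ν X ℱ Y W I A) (n : ℕ) (r : ℝ)
    {g : (Fin c → ℝ) → ℝ≥0∞} (hg : Measurable g) :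
    ∫⁻ ω, (if renewalTime W n ω ≤ r ∧ r < renewalTime W (n + 1) ω then g (Y n ω) else 0) ∂P =
      ∫⁻ ω, (if renewalTime W n ω ≤ r then g (Y n ω) *
        ENNReal.ofReal (Real.exp (-(r - renewalTime W n ω) * rate (Y n ω))) else 0) ∂P := by
  have hY := h.measurable_pos' n
  have hT := h.measurable_renewalTime' n
  have hgm : Measurable fun p : ((ℝ × (Fin c → ℝ)) × ℝ) × (Fin c → Fin c → ℝ) =>
      (if p.1.1.1 ≤ r ∧ r < p.1.1.1 + p.1.2 then g p.1.1.2 else 0) := by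
    refine Measurable.ite ?_ (by fun_prop) measurable_const
    exact (measurableSet_le (by fun_prop : Measurable fun p :
      ((ℝ × (Fin c → ℝ)) × ℝ) × (Fin c → Fin c → ℝ) => p.1.1.1) measurable_const).inter
      (measurableSet_lt measurable_const (by fun_prop : Measurable fun p :
        ((ℝ × (Fin c → ℝ)) × ℝ) × (Fin c → Fin c → ℝ) => p.1.1.1 + p.1.2))
  have hs := h.lintegral_step_sum n fun _ : Fin c => hgm
  simp only [← renewalTime_succ, lintegral_const, measure_univ, mul_one] at hs
  rw [hs, ← lintegral_finsetSum]
  · refine lintegral_congr_ae ?_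
    filter_upwards [h.rate_pos_ae] with ω hω
    by_cases hle : renewalTime W n ω ≤ r
    · simp only [hle, true_and, if_true]
      have : ∀ i, (∫⁻ w in Ioi (0 : ℝ), stepDensity i (Y n ω) w *
          (if r < renewalTime W n ω + w then g (Y n ω) else 0)) =
          g (Y n ω) * ENNReal.ofReal (Real.exp (-(r - renewalTime W n ω) * rate (Y n ω)) *
            (Y n ω i / rate (Y n ω))) := by
        intro i
        rw [← lintegral_Ioi_exp_neg_mul (hω n).2 ((hω n).1 i), ← lintegral_const_mul _
          (by fun_prop), ← inter_eq_left.mpr (Ioi_subset_Ioi (sub_nonneg.mpr hle)),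
          ← Measure.restrict_restrict measurableSet_Ioi, ← lintegral_indicator (μ := volume.restrict (Ioi 0))
            (measurableSet_Ioi (a := r - renewalTime W n ω))]
        refine lintegral_congr fun w => ?_
        by_cases hw : r - renewalTime W n ω < w
        · rw [indicator_of_mem (by exact hw), if_pos (by linarith), mul_comm]
          rfl
        · rw [indicator_of_notMem (by exact hw), if_neg (by linarith), mul_zero]
      simp_rw [this]
      rw [← Finset.mul_sum, ← ENNReal.ofReal_sum_of_nonneg fun i _ =>
        mul_nonneg (Real.exp_pos _).le (div_nonneg ((hω n).1 i) (hω n).2.le),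
        ← Finset.mul_sum, ← Finset.sum_div]
      change g (Y n ω) * ENNReal.ofReal (_ * (rate (Y n ω) / rate (Y n ω))) = _
      rw [div_self (hω n).2.ne', mul_one]
    · simp [hle]
  · intro i _
    refine Measurable.lintegral_prod_right' (ν := volume.restrict (Ioi (0:ℝ)))
      (f := fun p : Ω × ℝ => stepDensity i (Y n p.1) p.2 * (if renewalTime W n p.1 ≤ r ∧
        r < renewalTime W n p.1 + p.2 then g (Y n p.1) else 0)) ?_
    refine Measurable.mul ((measurable_stepDensity i).comp
      (by fun_prop : Measurable fun p : Ω × ℝ => (Y n p.1, p.2))) ?_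
    exact hgm.comp (by fun_prop : Measurable fun p : Ω × ℝ =>
      (((renewalTime W n p.1, Y n p.1), p.2), (0 : Fin c → Fin c → ℝ)))

/-- Exactly one term of the series is selected. Since `X` carries no measurability assumption, its
measurability also has to come from this series. -/
lemma comp_position_ae_eq (h : IsWalkWith P ν X ℱ Y W I A) {r : ℝ} (hr : 0 ≤ r)
    (g : (Fin c → ℝ) → ℝ≥0∞) : (fun ω => g (X r ω)) =ᵐ[P] fun ω => ∑' n,
      if renewalTime W n ω ≤ r ∧ r < renewalTime W (n + 1) ω then g (Y n ω) else 0 := by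
  filter_upwards [h.exists_renewal_interval_ae] with ω hω
  obtain ⟨n, hX, hn⟩ := hω r hr
  simp only [hn]
  rw [tsum_eq_single n fun m hm => by simp [hm], if_pos rfl, hX]

lemma lintegral_position (h : IsWalkWith P ν X ℱ Y W I A) {r : ℝ} (hr : 0 ≤ r)
    {g : (Fin c → ℝ) → ℝ≥0∞} (hg : Measurable g) :
    ∫⁻ ω, g (X r ω) ∂P = ∑' n, ∫⁻ ω, (if renewalTime W n ω ≤ r then g (Y n ω) *
        ENNReal.ofReal (Real.exp (-(r - renewalTime W n ω) * rate (Y n ω))) else 0) ∂P := by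
  rw [lintegral_congr_ae (h.comp_position_ae_eq hr g), lintegral_tsum fun n =>
    (h.measurable_renewal_interval_ite r n hg).aemeasurable]
  exact tsum_congr fun n => h.lintegral_renewal_interval n r hg

end IsWalkWith
end PolyaWalk

end

/-! ### Duhamel formula on characteristic lines. -/

noncomputable section

namespace PolyaWalk

open Set ENNReal

variable {Ω : Type*} [mΩ : MeasurableSpace Ω] {P : Measure Ω} {c : ℕ}
  {ν : Measure (Fin c → Fin c → ℝ)} {X : ℝ → Ω → Fin c → ℝ}
  {ℱ : Filtration ℕ mΩ} {Y : ℕ → Ω → Fin c → ℝ} {W : ℕ → Ω → ℝ} {I : ℕ → Ω → Fin c}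
  {A : ℕ → Ω → Fin c → Fin c → ℝ}

namespace IsWalkWith


lemma measurable_gain_term [IsProbabilityMeasure ν] (h : IsWalkWith P ν X ℱ Y W I A) (n : ℕ)
    {f : (Fin c → ℝ) → ℝ≥0∞} (hf : Measurable f) :
    Measurable (Function.uncurry fun r ω => if renewalTime W n ω ≤ r then gain ν f r (Y n ω) *
      ENNReal.ofReal (Real.exp (-(r - renewalTime W n ω) * rate (Y n ω))) else 0) := by
  have hY := h.measurable_pos' n
  have hT := h.measurable_renewalTime' n
  refine Measurable.ite (measurableSet_le (by fun_prop) measurable_fst) (Measurable.mul ?_ ?_)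
    measurable_const
  · exact (measurable_gain ν hf).comp (by fun_prop : Measurable fun p : ℝ × Ω => (p.1, Y n p.2))
  · fun_prop

variable [IsProbabilityMeasure P] [IsProbabilityMeasure ν]

/-- The `(n + 1)`-st renewal is disintegrated by its time `r = renewalTime W n + w`. The waiting
density at `w` splits into the holding factor up to `r` and the rate `y i`, which is absorbed in
`gain`. -/
lemma lintegral_jump (h : IsWalkWith P ν X ℱ Y W I A) (n : ℕ) (t : ℝ)
    {f : (Fin c → ℝ) → ℝ≥0∞} (hf : Measurable f) :
    ∫⁻ ω, (if renewalTime W (n + 1) ω ≤ t then f (Y (n + 1) ω) *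
        ENNReal.ofReal (Real.exp (renewalTime W (n + 1) ω * rate (Y (n + 1) ω))) else 0) ∂P =
      ∫⁻ r in Ioc 0 t, ∫⁻ ω, (if renewalTime W n ω ≤ r then gain ν f r (Y n ω) *
        ENNReal.ofReal (Real.exp (-(r - renewalTime W n ω) * rate (Y n ω))) else 0) ∂P := by
  have hY := h.measurable_pos' n
  have hT := h.measurable_renewalTime' n
  let g : Fin c → ((ℝ × (Fin c → ℝ)) × ℝ) × (Fin c → Fin c → ℝ) → ℝ≥0∞ := fun i p =>
    if p.1.1.1 + p.1.2 ≤ t then f (p.1.1.2 + p.2 i) *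
      ENNReal.ofReal (Real.exp ((p.1.1.1 + p.1.2) * rate (p.1.1.2 + p.2 i))) else 0
  have hg : ∀ i, Measurable (g i) := fun i => by
    refine Measurable.ite ?_ (by fun_prop) measurable_const
    exact measurableSet_le (by fun_prop : Measurable fun p :
      ((ℝ × (Fin c → ℝ)) × ℝ) × (Fin c → Fin c → ℝ) => p.1.1.1 + p.1.2) measurable_const
  have e1 : ∫⁻ ω, (if renewalTime W (n + 1) ω ≤ t then f (Y (n + 1) ω) *
        ENNReal.ofReal (Real.exp (renewalTime W (n + 1) ω * rate (Y (n + 1) ω))) else 0) ∂P =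
      ∫⁻ ω, g (I n ω) (((renewalTime W n ω, Y n ω), W n ω), A n ω) ∂P := by
    refine lintegral_congr_ae ?_
    filter_upwards [h.step_eq] with ω hω
    have : Y (n + 1) ω = Y n ω + A n ω (I n ω) := funext fun j => hω n j
    simp only [g, this, renewalTime_succ]
  have hin : ∀ i, Measurable fun p : Ω × ℝ => stepDensity i (Y n p.1) p.2 *
        ∫⁻ M, g i (((renewalTime W n p.1, Y n p.1), p.2), M) ∂ν := fun i => by
    refine Measurable.mul ((measurable_stepDensity i).comp
      (by fun_prop : Measurable fun p : Ω × ℝ => (Y n p.1, p.2))) ?_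
    exact (hg i).lintegral_prod_right'.comp
      (by fun_prop : Measurable fun p : Ω × ℝ => ((renewalTime W n p.1, Y n p.1), p.2))
  rw [e1, h.lintegral_step_sum n hg, ← lintegral_finsetSum _ fun i _ =>
    (hin i).lintegral_prod_right', lintegral_lintegral_swap
    (h.measurable_gain_term n hf).aemeasurable]
  refine lintegral_congr_ae ?_
  filter_upwards [h.rate_pos_ae, h.strictMono_renewalTime_ae] with ω hω hmono
  have hT0 : 0 ≤ renewalTime W n ω := by
    simpa [renewalTime] using hmono.monotone (Nat.zero_le n)
  have hin' : ∀ i, Measurable fun w => stepDensity i (Y n ω) w *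
      ∫⁻ M, g i (((renewalTime W n ω, Y n ω), w), M) ∂ν :=
    fun i => (hin i).comp measurable_prodMk_left
  rw [← lintegral_finsetSum _ fun i _ => hin' i,
    ← lintegral_indicator measurableSet_Ioi, ← lintegral_sub_right_eq_self _ (renewalTime W n ω),
    ← lintegral_indicator measurableSet_Ioc]
  refine lintegral_congr_ae ?_
  -- The waiting-time integral has `w > 0` and the target has `renewalTime W n ω ≤ r`; they differ
  -- only at this null point.
  filter_upwards [Measure.ae_ne volume (renewalTime W n ω)] with r hr
  by_cases hlt : renewalTime W n ω < r
  · rw [indicator_of_mem (by exact sub_pos.mpr hlt)]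
    by_cases hrt : r ≤ t
    · rw [indicator_of_mem (by exact ⟨hT0.trans_lt hlt, hrt⟩), if_pos hlt.le, gain,
        Finset.sum_mul]
      refine Finset.sum_congr rfl fun i _ => ?_
      simp only [g, add_sub_cancel, if_pos hrt, stepDensity]
      rw [ENNReal.ofReal_mul (Real.exp_pos _).le]
      ring
    · rw [indicator_of_notMem (by exact fun hh => hrt hh.2)]
      simp [g, hrt]
  · rw [indicator_of_notMem (by simpa using not_lt.mp hlt), indicator_apply]
    rw [if_neg (fun hle => hlt (lt_of_le_of_ne hle (Ne.symm hr))), ite_self]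

/-- Duhamel formula along the characteristic lines `s ↦ v + s • 1` of the differential equation. -/
theorem lintegral_exp_rate_eq (h : IsWalkWith P ν X ℱ Y W I A) {t : ℝ} (ht : 0 ≤ t)
    {f : (Fin c → ℝ) → ℝ≥0∞} (hf : Measurable f) :
    ∫⁻ ω, f (X t ω) * ENNReal.ofReal (Real.exp (t * rate (X t ω))) ∂P =
      ∫⁻ ω, f (Y 0 ω) ∂P + ∫⁻ r in Ioc 0 t, ∫⁻ ω, gain ν f r (X r ω) ∂P := by
  have hpos := h.lintegral_position ht (g := fun y => f y * ENNReal.ofReal (Real.exp (t * rate y)))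
    (by fun_prop)
  have hgain : ∫⁻ r in Ioc 0 t, ∫⁻ ω, gain ν f r (X r ω) ∂P = ∑' n, ∫⁻ r in Ioc 0 t, ∫⁻ ω,
      (if renewalTime W n ω ≤ r then gain ν f r (Y n ω) *
        ENNReal.ofReal (Real.exp (-(r - renewalTime W n ω) * rate (Y n ω))) else 0) ∂P := by
    refine Eq.trans ?_ (lintegral_tsum fun n =>
      (h.measurable_gain_term n hf).lintegral_prod_right'.aemeasurable)
    refine setLIntegral_congr_fun measurableSet_Ioc fun r hr => ?_
    exact h.lintegral_position hr.1.le ((measurable_gain ν hf).comp measurable_prodMk_left)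
  -- The term `n = 0` is the initial position; the term `n + 1` will match the `n`-th term of the
  -- gain series.
  rw [hpos, hgain, tsum_eq_zero_add' ENNReal.summable]
  -- The cancellation behind the choice of characteristics: `t - (t - T) = T`, so `t` survives only
  -- in the indicator.
  have hexp : ∀ n ω, (if renewalTime W n ω ≤ t then f (Y n ω) *
      ENNReal.ofReal (Real.exp (t * rate (Y n ω))) *
        ENNReal.ofReal (Real.exp (-(t - renewalTime W n ω) * rate (Y n ω))) else 0) =
      if renewalTime W n ω ≤ t then f (Y n ω) *
        ENNReal.ofReal (Real.exp (renewalTime W n ω * rate (Y n ω))) else 0 := fun n ω => by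
    rw [mul_assoc, ← ENNReal.ofReal_mul (Real.exp_pos _).le, ← Real.exp_add]
    ring_nf
  simp_rw [hexp]
  congr 1
  · simp [renewalTime, ht]
  · exact tsum_congr fun n => h.lintegral_jump n t hf

end IsWalkWith
end PolyaWalk

end

/-! ### Monotonicity and continuity of weighted moment generating functions. -/

noncomputable section

namespace PolyaWalk

open Set ENNReal

section Exponentials

variable {c : ℕ}

/-- The function `y ↦ exp (∑ j, v j * y j)` with values in `ℝ≥0∞`. -/
def expDot (v y : Fin c → ℝ) : ℝ≥0∞ := ENNReal.ofReal (Real.exp (∑ j, v j * y j))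

/-- Translation of `u` by `x` in the diagonal direction. -/
def shift (u : Fin c → ℝ) (x : ℝ) : Fin c → ℝ := fun j => u j + x

lemma shift_shift (u : Fin c → ℝ) (x y : ℝ) : shift (shift u x) y = shift u (x + y) := by
  ext j; simp [shift, add_assoc]

@[simp]
lemma shift_zero (u : Fin c → ℝ) : shift u 0 = u := by
  ext j; simp [shift]

lemma shift_mono (u : Fin c → ℝ) {x y : ℝ} (h : x ≤ y) : shift u x ≤ shift u y :=
  fun j => by simpa [shift] using h

lemma sum_shift_mul (v : Fin c → ℝ) (x : ℝ) (y : Fin c → ℝ) :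
    ∑ j, shift v x j * y j = ∑ j, v j * y j + x * rate y := by
  simp only [shift, rate, add_mul, Finset.sum_add_distrib, Finset.mul_sum]

lemma expDot_shift (v : Fin c → ℝ) (x : ℝ) (y : Fin c → ℝ) :
    expDot (shift v x) y = expDot v y * ENNReal.ofReal (Real.exp (x * rate y)) := by
  rw [expDot, sum_shift_mul, Real.exp_add, ENNReal.ofReal_mul (Real.exp_pos _).le, expDot]

lemma expDot_add (v y z : Fin c → ℝ) : expDot v (y + z) = expDot v y * expDot v z := by
  simp only [expDot, Pi.add_apply, mul_add, Finset.sum_add_distrib, Real.exp_add]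
  rw [ENNReal.ofReal_mul (Real.exp_pos _).le]

lemma expDot_ne_zero (v y : Fin c → ℝ) : expDot v y ≠ 0 := by
  simp [expDot, Real.exp_pos]

@[fun_prop]
lemma measurable_expDot (v : Fin c → ℝ) : Measurable (expDot v) := by
  unfold expDot; fun_prop

lemma expDot_mono {v w y : Fin c → ℝ} (hy : ∀ i, 0 ≤ y i) (h : v ≤ w) :
    expDot v y ≤ expDot w y :=
  ofReal_le_ofReal <| Real.exp_le_exp.mpr <|
    Finset.sum_le_sum fun i _ => mul_le_mul_of_nonneg_right (h i) (hy i)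

lemma continuous_expDot_shift (v y : Fin c → ℝ) : Continuous fun x => expDot (shift v x) y := by
  simp only [expDot, sum_shift_mul]
  exact ENNReal.continuous_ofReal.comp (by fun_prop)

/-- A shifted exponential lies below the sum of the exponentials at two shifts around it. -/
lemma expDot_shift_le_add (u y : Fin c → ℝ) {a x b : ℝ} (ha : a ≤ x) (hb : x ≤ b) :
    expDot (shift u x) y ≤ expDot (shift u a) y + expDot (shift u b) y := by
  simp only [expDot_shift, ← mul_add]
  gcongr
  rcases le_total 0 (rate y) with h | h
  · exact (ofReal_le_ofReal (Real.exp_le_exp.mpr (mul_le_mul_of_nonneg_right hb h))).trans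
      le_add_self
  · exact (ofReal_le_ofReal (Real.exp_le_exp.mpr (mul_le_mul_of_nonpos_right ha h))).trans
      le_self_add

end Exponentials

/-- Moment generating function of the position at time `s`, with weight `k`. -/
def weightedMgf {Ω : Type*} [MeasurableSpace Ω] (P : Measure Ω) {c : ℕ}
    (X : ℝ → Ω → Fin c → ℝ) (k : (Fin c → ℝ) → ℝ≥0∞) (s : ℝ) (v : Fin c → ℝ) : ℝ≥0∞ :=
  ∫⁻ ω, k (X s ω) * expDot v (X s ω) ∂P

/-- Moment generating function of row `i` of the navigation matrix, with values in `ℝ≥0∞`. -/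
def rowMgf {c : ℕ} (ν : Measure (Fin c → Fin c → ℝ)) (i : Fin c) (v : Fin c → ℝ) : ℝ≥0∞ :=
  ∫⁻ M, expDot v (M i) ∂ν

/-- The `i`-th coordinate, as a weight. -/
def coord {c : ℕ} (i : Fin c) (y : Fin c → ℝ) : ℝ≥0∞ := ENNReal.ofReal (y i)

@[fun_prop]
lemma measurable_coord {c : ℕ} (i : Fin c) : Measurable (coord i) := by
  unfold coord; fun_prop

/-- Absolute continuity of the integral makes the error over `uIoc t s` vanish; the two integrals
differ by at most that error in either direction. -/
lemma tendsto_setLIntegral_Ioc {G : ℝ → ℝ≥0∞} {t b : ℝ} (ht : t < b)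
    (hG : ∫⁻ r in Ioc 0 b, G r ≠ ∞) :
    Tendsto (fun s => ∫⁻ r in Ioc 0 s, G r) (𝓝[Ici 0] t) (𝓝 (∫⁻ r in Ioc 0 t, G r)) := by
  let E : ℝ → ℝ≥0∞ := fun s => ∫⁻ r in uIoc t s, G r ∂(volume.restrict (Ioc 0 b))
  have hE : Tendsto E (𝓝[Ici 0] t) (𝓝 0) := by
    refine tendsto_setLIntegral_zero hG ?_
    have : Tendsto (fun s => ENNReal.ofReal |s - t|) (𝓝[Ici 0] t) (𝓝 0) := by
      have : ContinuousAt (fun s => ENNReal.ofReal |s - t|) t :=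
        (ENNReal.continuous_ofReal.comp (by fun_prop)).continuousAt
      simpa using this.tendsto.mono_left nhdsWithin_le_nhds
    refine tendsto_of_tendsto_of_tendsto_of_le_of_le tendsto_const_nhds this
      (fun _ => zero_le) fun s => ?_
    exact (Measure.restrict_apply_le _ _).trans (by simp)
  have hfin : ∫⁻ r in Ioc 0 t, G r ≠ ∞ :=
    ne_top_of_le_ne_top hG (lintegral_mono_set (Ioc_subset_Ioc_right ht.le))
  have key : ∀ x y : ℝ, x ≤ b → y ≤ b → ∫⁻ r in Ioc 0 x, G r ≤ (∫⁻ r in Ioc 0 y, G r) +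
      ∫⁻ r in uIoc y x, G r ∂(volume.restrict (Ioc 0 b)) := by
    intro x y hx hy
    rw [Measure.restrict_restrict measurableSet_uIoc]
    refine (lintegral_mono_set ?_).trans (lintegral_union_le _ _ _)
    intro r hr
    rcases le_or_gt r y with h | h
    · exact Or.inl ⟨hr.1, h⟩
    · exact Or.inr ⟨mem_uIoc.mpr (Or.inl ⟨h, hr.2⟩), hr.1, hr.2.trans hx⟩
  have hev : ∀ᶠ s in 𝓝[Ici 0] t, s ≤ b :=
    mem_nhdsWithin_of_mem_nhds (Iic_mem_nhds ht)
  have h1 : Tendsto (fun s => (∫⁻ r in Ioc 0 t, G r) - E s) (𝓝[Ici 0] t)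
      (𝓝 (∫⁻ r in Ioc 0 t, G r)) := by
    simpa using ENNReal.Tendsto.sub (tendsto_const_nhds (x := ∫⁻ r in Ioc 0 t, G r)) hE
      (Or.inl hfin)
  have h2 : Tendsto (fun s => (∫⁻ r in Ioc 0 t, G r) + E s) (𝓝[Ici 0] t)
      (𝓝 (∫⁻ r in Ioc 0 t, G r)) := by
    simpa using (tendsto_const_nhds (x := ∫⁻ r in Ioc 0 t, G r)).add hE
  refine tendsto_of_tendsto_of_tendsto_of_le_of_le' h1 h2 ?_ ?_
  · filter_upwards [hev] with s hs
    rw [tsub_le_iff_right]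
    simpa only [E, uIoc_comm] using key t s ht.le hs
  · filter_upwards [hev] with s hs
    exact key s t hs ht.le

variable {Ω : Type*} [mΩ : MeasurableSpace Ω] {P : Measure Ω} {c : ℕ}
  {ν : Measure (Fin c → Fin c → ℝ)} {X : ℝ → Ω → Fin c → ℝ}
  {ℱ : Filtration ℕ mΩ} {Y : ℕ → Ω → Fin c → ℝ} {W : ℕ → Ω → ℝ} {I : ℕ → Ω → Fin c}
  {A : ℕ → Ω → Fin c → Fin c → ℝ}

namespace IsWalkWith

variable [IsProbabilityMeasure P] [IsProbabilityMeasure ν]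

lemma position_nonneg_ae (h : IsWalkWith P ν X ℱ Y W I A) {s : ℝ} (hs : 0 ≤ s) :
    ∀ᵐ ω ∂P, ∀ i, 0 ≤ X s ω i := by
  filter_upwards [h.exists_renewal_interval_ae, h.tenable] with ω hω hY i
  obtain ⟨n, hX, -⟩ := hω s hs
  rw [hX]
  exact (hY n).1 i

lemma aemeasurable_position (h : IsWalkWith P ν X ℱ Y W I A) {s : ℝ} (hs : 0 ≤ s) :
    AEMeasurable (X s) P := by
  refine aemeasurable_pi_lambda _ fun i => ?_
  have h1 : AEMeasurable (fun ω => coord i (X s ω)) P :=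
    (AEMeasurable.tsum fun n =>
      (h.measurable_renewal_interval_ite s n (measurable_coord i)).aemeasurable).congr
      (h.comp_position_ae_eq hs (coord i)).symm
  refine h1.ennreal_toReal.congr ?_
  filter_upwards [h.position_nonneg_ae hs] with ω hω
  exact ENNReal.toReal_ofReal (hω i)

lemma weightedMgf_shift_eq (h : IsWalkWith P ν X ℱ Y W I A) {k : (Fin c → ℝ) → ℝ≥0∞}
    (hk : Measurable k) (v : Fin c → ℝ) {s : ℝ} (hs : 0 ≤ s) :
    weightedMgf P X k s (shift v s) = ∫⁻ ω, k (Y 0 ω) * expDot v (Y 0 ω) ∂P +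
      ∫⁻ r in Ioc 0 s, ∫⁻ ω, gain ν (fun y => k y * expDot v y) r (X r ω) ∂P := by
  rw [← h.lintegral_exp_rate_eq hs (f := fun y => k y * expDot v y) (by fun_prop)]
  simp only [weightedMgf, expDot_shift, mul_assoc]

/-- Along a characteristic line only the upper limit of a nonnegative integral changes in the
Duhamel formula. -/
lemma weightedMgf_le_shift (h : IsWalkWith P ν X ℱ Y W I A) {k : (Fin c → ℝ) → ℝ≥0∞}
    (hk : Measurable k) (v : Fin c → ℝ) {s s' : ℝ} (hs : 0 ≤ s) (hss' : s ≤ s') :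
    weightedMgf P X k s v ≤ weightedMgf P X k s' (shift v (s' - s)) := by
  have h1 := h.weightedMgf_shift_eq hk (shift v (-s)) hs
  have h2 := h.weightedMgf_shift_eq hk (shift v (-s)) (hs.trans hss')
  rw [shift_shift, neg_add_cancel, shift_zero] at h1
  rw [shift_shift, neg_add_eq_sub] at h2
  rw [h1, h2]
  gcongr

lemma weightedMgf_mono (h : IsWalkWith P ν X ℱ Y W I A) (k : (Fin c → ℝ) → ℝ≥0∞)
    {v w : Fin c → ℝ} (hvw : v ≤ w) {s : ℝ} (hs : 0 ≤ s) :
    weightedMgf P X k s v ≤ weightedMgf P X k s w := by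
  refine lintegral_mono_ae ?_
  filter_upwards [h.position_nonneg_ae hs] with ω hω
  gcongr
  exact expDot_mono hω hvw

lemma tendsto_weightedMgf_shift (h : IsWalkWith P ν X ℱ Y W I A) {k : (Fin c → ℝ) → ℝ≥0∞}
    (hk : Measurable k) {v : Fin c → ℝ} {t b : ℝ} (ht : 0 ≤ t) (hb : t < b)
    (hfin : weightedMgf P X k b (shift v (b - t)) ≠ ∞) :
    Tendsto (fun s => weightedMgf P X k s (shift v (s - t))) (𝓝[Ici 0] t)
      (𝓝 (weightedMgf P X k t v)) := by
  have key : ∀ s, 0 ≤ s → weightedMgf P X k s (shift v (s - t)) = _ + _ := fun s hs => by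
    have := h.weightedMgf_shift_eq hk (shift v (-t)) hs
    rwa [shift_shift, neg_add_eq_sub] at this
  have hlim := (tendsto_const_nhds (x := ∫⁻ ω, k (Y 0 ω) * expDot (shift v (-t)) (Y 0 ω) ∂P)
    (f := 𝓝[Ici 0] t)).add (tendsto_setLIntegral_Ioc hb (G := fun r => ∫⁻ ω, gain ν
      (fun y => k y * expDot (shift v (-t)) y) r (X r ω) ∂P) (by
        rw [key b (ht.trans hb.le)] at hfin
        exact (ENNReal.add_ne_top.mp hfin).2))
  rw [← key t ht, sub_self, shift_zero] at hlim
  refine hlim.congr' ?_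
  filter_upwards [self_mem_nhdsWithin] with s hs
  exact (key s hs).symm

/-- Dominated convergence; positions being nonnegative, a bound at the upper shift `ε` is enough. -/
lemma tendsto_weightedMgf_space (h : IsWalkWith P ν X ℱ Y W I A) {k : (Fin c → ℝ) → ℝ≥0∞}
    (hk : Measurable k) {u : Fin c → ℝ} {t ε : ℝ} (ht : 0 ≤ t) (hε : 0 < ε)
    (hfin : weightedMgf P X k t (shift u ε) ≠ ∞) :
    Tendsto (fun x => weightedMgf P X k t (shift u x)) (𝓝 0) (𝓝 (weightedMgf P X k t u)) := by
  have hX := h.aemeasurable_position ht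
  refine tendsto_lintegral_filter_of_dominated_convergence'
    (fun ω => k (X t ω) * expDot (shift u ε) (X t ω)) ?_ ?_ hfin ?_
  · exact Eventually.of_forall fun x =>
      (hk.mul (measurable_expDot _)).comp_aemeasurable hX
  · filter_upwards [Iic_mem_nhds hε] with x hx
    filter_upwards [h.position_nonneg_ae ht] with ω hω
    gcongr
    exact expDot_mono hω (shift_mono u hx)
  · refine ae_of_all _ fun ω => ENNReal.Tendsto.const_mul ?_ (Or.inl (expDot_ne_zero _ _))
    simpa using (continuous_expDot_shift u (X t ω)).tendsto 0

/-- The weighted moment generating function is continuous where it is finite. -/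
theorem tendsto_weightedMgf (h : IsWalkWith P ν X ℱ Y W I A) {k : (Fin c → ℝ) → ℝ≥0∞}
    (hk : Measurable k) {u : Fin c → ℝ} {t ε : ℝ} (ht : 0 ≤ t) (hε : 0 < ε)
    (hfin : ∀ s v, 0 ≤ s → |s - t| < ε → dist v u < ε → weightedMgf P X k s v ≠ ∞) :
    Tendsto (fun p : ℝ × (Fin c → ℝ) => weightedMgf P X k p.1 p.2)
      (𝓝[Ici 0 ×ˢ univ] (t, u)) (𝓝 (weightedMgf P X k t u)) := by
  have hdist : ∀ x : ℝ, |x| < ε → dist (shift u x) u < ε := fun x hx => by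
    rw [dist_pi_lt_iff hε]
    intro j
    simpa [shift, Real.dist_eq] using hx
  have hspace := h.tendsto_weightedMgf_space hk (u := u) ht (half_pos hε)
    (hfin t _ ht (by simpa using hε) (hdist _ (by rw [abs_of_pos] <;> linarith)))
  have htime : ∀ x : ℝ, |x| < ε / 2 → Tendsto (fun p : ℝ × (Fin c → ℝ) =>
      weightedMgf P X k p.1 (shift u (x + (p.1 - t)))) (𝓝[Ici 0 ×ˢ univ] (t, u))
      (𝓝 (weightedMgf P X k t (shift u x))) := by
    intro x hx
    have := h.tendsto_weightedMgf_shift hk (v := shift u x) (t := t) (b := t + ε / 2) ht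
      (by linarith) (by
        rw [shift_shift]
        refine hfin _ _ (by linarith) ?_ (hdist _ ?_)
        · rw [add_sub_cancel_left, abs_of_pos] <;> linarith
        · rw [add_sub_cancel_left]
          rw [abs_lt] at hx ⊢
          constructor <;> linarith)
    simp only [shift_shift] at this
    exact this.comp (tendsto_nhdsWithin_iff.mpr ⟨(continuous_fst.tendsto (t, u)).mono_left
      nhdsWithin_le_nhds, eventually_nhdsWithin_of_forall fun p hp => hp.1⟩)
  -- Every nearby point lies between the characteristic lines through `shift u (-η)` and `shift u η`
  -- at time `t`. The radius `η / 2` is spent once on time and once on space.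
  have hnear : ∀ η : ℝ, 0 < η → ∀ᶠ p in 𝓝[Ici 0 ×ˢ univ] ((t, u) : ℝ × (Fin c → ℝ)),
      0 ≤ p.1 ∧ shift u (-η + (p.1 - t)) ≤ p.2 ∧ p.2 ≤ shift u (η + (p.1 - t)) := by
    intro η hη
    filter_upwards [self_mem_nhdsWithin, mem_nhdsWithin_of_mem_nhds
      (Metric.ball_mem_nhds ((t, u) : ℝ × (Fin c → ℝ)) (half_pos hη))] with p hp1 hp2
    rw [Metric.mem_ball, Prod.dist_eq, max_lt_iff, Real.dist_eq, dist_pi_lt_iff (half_pos hη),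
      abs_lt] at hp2
    refine ⟨hp1.1, fun j => ?_, fun j => ?_⟩
    all_goals
      have := hp2.2 j
      rw [Real.dist_eq, abs_lt] at this
      simp only [shift]
      linarith [hp2.1.1, hp2.1.2]
  rw [tendsto_order]
  constructor
  · intro a ha
    have h1 : ∀ᶠ x in 𝓝 (0 : ℝ), a < weightedMgf P X k t (shift u x) := hspace.eventually_const_lt ha
    obtain ⟨δ, hδ, hball⟩ := Metric.eventually_nhds_iff.mp h1
    -- The bound `δ / 2` keeps the value at the shifted point above `a`; `ε / 4` keeps the shift
    -- within the range of `htime`.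
    have hη : 0 < min (δ / 2) (ε / 4) := by positivity
    have hx : |-(min (δ / 2) (ε / 4))| < ε / 2 := by
      rw [abs_neg, abs_of_pos hη]
      linarith [min_le_right (δ / 2) (ε / 4)]
    have h2 : a < weightedMgf P X k t (shift u (-(min (δ / 2) (ε / 4)))) := by
      refine hball ?_
      rw [dist_zero_right, Real.norm_eq_abs, abs_neg, abs_of_pos hη]
      linarith [min_le_left (δ / 2) (ε / 4)]
    filter_upwards [(htime _ hx).eventually_const_lt h2, hnear _ hη] with p hp1 hp2
    exact hp1.trans_le (h.weightedMgf_mono k hp2.2.1 hp2.1)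
  · intro a ha
    have h1 : ∀ᶠ x in 𝓝 (0 : ℝ), weightedMgf P X k t (shift u x) < a := hspace.eventually_lt_const ha
    obtain ⟨δ, hδ, hball⟩ := Metric.eventually_nhds_iff.mp h1
    have hη : 0 < min (δ / 2) (ε / 4) := by positivity
    have hx : |min (δ / 2) (ε / 4)| < ε / 2 := by
      rw [abs_of_pos hη]
      linarith [min_le_right (δ / 2) (ε / 4)]
    have h2 : weightedMgf P X k t (shift u (min (δ / 2) (ε / 4))) < a := by
      refine hball ?_
      rw [dist_zero_right, Real.norm_eq_abs, abs_of_pos hη]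
      linarith [min_le_left (δ / 2) (ε / 4)]
    filter_upwards [(htime _ hx).eventually_lt_const h2, hnear _ hη] with p hp1 hp2
    exact (h.weightedMgf_mono k hp2.2.2 hp2.1).trans_lt hp1

end IsWalkWith
end PolyaWalk

end

/-! ### Row generating functions, the integrand of the Duhamel formula, and convexity. -/

noncomputable section

namespace PolyaWalk

open Set ENNReal

/-- The squeeze is stated with products instead of quotients, so that no case distinction on the
sign of `x - t` is needed. -/
lemma hasDerivWithinAt_of_le_of_le {F a b : ℝ → ℝ} {S : Set ℝ} {t L : ℝ}
    (ha : Tendsto a (𝓝[S] t) (𝓝 L)) (hb : Tendsto b (𝓝[S] t) (𝓝 L))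
    (hle : ∀ᶠ x in 𝓝[S] t, (x - t) * a x ≤ F x - F t)
    (hge : ∀ᶠ x in 𝓝[S] t, F x - F t ≤ (x - t) * b x) : HasDerivWithinAt F L S t := by
  rw [hasDerivWithinAt_iff_isLittleO, Asymptotics.isLittleO_iff]
  intro δ hδ
  filter_upwards [hle, hge, Metric.tendsto_nhds.mp ha δ hδ, Metric.tendsto_nhds.mp hb δ hδ]
    with x h1 h2 h3 h4
  rw [Real.dist_eq] at h3 h4
  rw [smul_eq_mul, Real.norm_eq_abs, Real.norm_eq_abs]
  have e1 : |(x - t) * (a x - L)| ≤ δ * |x - t| := by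
    rw [abs_mul, mul_comm]
    exact mul_le_mul_of_nonneg_right h3.le (abs_nonneg _)
  have e2 : |(x - t) * (b x - L)| ≤ δ * |x - t| := by
    rw [abs_mul, mul_comm]
    exact mul_le_mul_of_nonneg_right h4.le (abs_nonneg _)
  rw [abs_le] at e1 e2 ⊢
  constructor
  · linarith [e1.1]
  · linarith [e2.2]

section RowMgf

variable {c : ℕ} {ν : Measure (Fin c → Fin c → ℝ)}

lemma rowMgf_ne_top_of_le {i : Fin c} {u : Fin c → ℝ} {a x b : ℝ} (ha : a ≤ x) (hb : x ≤ b)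
    (h1 : rowMgf ν i (shift u a) ≠ ∞) (h2 : rowMgf ν i (shift u b) ≠ ∞) :
    rowMgf ν i (shift u x) ≠ ∞ := by
  refine ne_top_of_le_ne_top (ENNReal.add_ne_top.mpr ⟨h1, h2⟩) ?_
  unfold rowMgf
  rw [← lintegral_add_left (by fun_prop)]
  exact lintegral_mono fun M => expDot_shift_le_add u (M i) ha hb

/-- Matrix entries may be negative, so domination needs finiteness on both sides. -/
lemma tendsto_rowMgf_shift {i : Fin c} {u : Fin c → ℝ} {δ : ℝ} (hδ : 0 < δ)
    (h1 : rowMgf ν i (shift u (-δ)) ≠ ∞) (h2 : rowMgf ν i (shift u δ) ≠ ∞) :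
    Tendsto (fun x => rowMgf ν i (shift u x)) (𝓝 0) (𝓝 (rowMgf ν i u)) := by
  refine tendsto_lintegral_filter_of_dominated_convergence
    (fun M => expDot (shift u (-δ)) (M i) + expDot (shift u δ) (M i)) ?_ ?_ ?_ ?_
  · exact Eventually.of_forall fun x => by fun_prop
  · filter_upwards [Icc_mem_nhds (neg_lt_zero.mpr hδ) hδ] with x hx
    exact ae_of_all _ fun M => expDot_shift_le_add u (M i) hx.1 hx.2
  · rw [lintegral_add_left (by fun_prop)]
    exact ENNReal.add_ne_top.mpr ⟨h1, h2⟩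
  · exact ae_of_all _ fun M => by simpa using (continuous_expDot_shift u (M i)).tendsto 0

/-- No finiteness is needed: in the infinite case both sides are zero by convention. -/
lemma toReal_rowMgf (i : Fin c) (u : Fin c → ℝ) : (rowMgf ν i u).toReal = psi ν i u := by
  rw [psi, integral_eq_lintegral_of_nonneg_ae (ae_of_all _ fun M => (Real.exp_pos _).le)
    (Measurable.aestronglyMeasurable (by fun_prop))]
  rfl

lemma integrable_of_rowMgf_ne_top {i : Fin c} {u : Fin c → ℝ} (h : rowMgf ν i u ≠ ∞) :
    Integrable (fun M : Fin c → Fin c → ℝ => Real.exp (∑ j, u j * M i j)) ν := by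
  refine (lintegral_ofReal_ne_top_iff_integrable
    (Measurable.aestronglyMeasurable (by fun_prop))
    (ae_of_all _ fun M => (Real.exp_pos _).le)).mp h

end RowMgf

variable {Ω : Type*} [mΩ : MeasurableSpace Ω] {P : Measure Ω} {c : ℕ}
  {ν : Measure (Fin c → Fin c → ℝ)} {X : ℝ → Ω → Fin c → ℝ}
  {ℱ : Filtration ℕ mΩ} {Y : ℕ → Ω → Fin c → ℝ} {W : ℕ → Ω → ℝ} {I : ℕ → Ω → Fin c}
  {A : ℕ → Ω → Fin c → Fin c → ℝ}

/-- Moment generating function of the position, with values in `ℝ≥0∞`. -/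
def mgfPos {Ω : Type*} [MeasurableSpace Ω] (P : Measure Ω) {c : ℕ} (X : ℝ → Ω → Fin c → ℝ)
    (s : ℝ) (v : Fin c → ℝ) : ℝ≥0∞ :=
  weightedMgf P X (fun _ => 1) s v

namespace IsWalkWith

variable [IsProbabilityMeasure P] [IsProbabilityMeasure ν]

/-- The exponential of a sum factors and the matrix is integrated separately from the position, so
each term of `gain` splits into a product. -/
lemma lintegral_gain_expDot (h : IsWalkWith P ν X ℱ Y W I A) (v : Fin c → ℝ) {r : ℝ}
    (hr : 0 ≤ r) :
    ∫⁻ ω, gain ν (fun y => 1 * expDot v y) r (X r ω) ∂P =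
      ∑ i, weightedMgf P X (coord i) r (shift v r) * rowMgf ν i (shift v r) := by
  have hX := h.aemeasurable_position hr
  have e : ∀ y, gain ν (fun y => 1 * expDot v y) r y =
      ∑ i, coord i y * expDot (shift v r) y * rowMgf ν i (shift v r) := by
    intro y
    refine Finset.sum_congr rfl fun i _ => ?_
    simp only [one_mul]
    simp only [← expDot_shift]
    simp only [expDot_add]
    rw [lintegral_const_mul _ (by fun_prop), mul_assoc]
    rfl
  simp_rw [e]
  have hm : ∀ i, AEMeasurable (fun ω => coord i (X r ω) * expDot (shift v r) (X r ω)) P :=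
    fun i => (by fun_prop : Measurable fun y => coord i y * expDot (shift v r) y).comp_aemeasurable
      hX
  rw [lintegral_finsetSum' _ fun i _ => (hm i).mul_const _]
  refine Finset.sum_congr rfl fun i _ => ?_
  rw [lintegral_mul_const'' _ (hm i)]
  rfl

/-- Joint measurability of `X` is not available, so measurability in time is read off from the
renewal series. -/
lemma aemeasurable_lintegral_gain (h : IsWalkWith P ν X ℱ Y W I A) {f : (Fin c → ℝ) → ℝ≥0∞}
    (hf : Measurable f) (b : ℝ) :
    AEMeasurable (fun r => ∫⁻ ω, gain ν f r (X r ω) ∂P) (volume.restrict (Ioc 0 b)) := by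
  have hm : AEMeasurable (fun r => ∑' n, ∫⁻ ω, (if renewalTime W n ω ≤ r then gain ν f r (Y n ω) *
      ENNReal.ofReal (Real.exp (-(r - renewalTime W n ω) * rate (Y n ω))) else 0) ∂P)
      (volume.restrict (Ioc 0 b)) :=
    AEMeasurable.tsum fun n =>
      ((h.measurable_gain_term n hf).lintegral_prod_right' (ν := P)).aemeasurable
  refine hm.congr ?_
  filter_upwards [ae_restrict_mem measurableSet_Ioc] with r hr
  exact (h.lintegral_position hr.1.le ((measurable_gain ν hf).comp measurable_prodMk_left)).symm

/-- The Duhamel formula for the moment generating function, on the characteristic line through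
`(t, u)`. -/
lemma mgfPos_shift_eq (h : IsWalkWith P ν X ℱ Y W I A) (t : ℝ) (u : Fin c → ℝ) :
    ∃ (C : ℝ≥0∞) (G : ℝ → ℝ≥0∞),
      (∀ b, AEMeasurable G (volume.restrict (Ioc 0 b))) ∧
      (∀ r, 0 ≤ r → G r = ∑ i, weightedMgf P X (coord i) r (shift u (r - t)) *
        rowMgf ν i (shift u (r - t))) ∧
      ∀ s, 0 ≤ s → mgfPos P X s (shift u (s - t)) = C + ∫⁻ r in Ioc 0 s, G r := by
  refine ⟨∫⁻ ω, 1 * expDot (shift u (-t)) (Y 0 ω) ∂P, _, fun b => h.aemeasurable_lintegral_gain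
    (f := fun y => 1 * expDot (shift u (-t)) y) (by fun_prop) b, fun r hr => ?_, fun s hs => ?_⟩
  · have := h.lintegral_gain_expDot (shift u (-t)) hr
    rwa [shift_shift, neg_add_eq_sub] at this
  · have := h.weightedMgf_shift_eq (k := fun _ => 1) measurable_const (shift u (-t)) hs
    rwa [shift_shift, neg_add_eq_sub] at this

/-- Follows from `η * x ≤ exp (η * x)`: a small diagonal shift pays for the factor `X_i`. -/
lemma weightedMgf_coord_le (h : IsWalkWith P ν X ℱ Y W I A) (i : Fin c) (v : Fin c → ℝ)
    {s η : ℝ} (hs : 0 ≤ s) (hη : 0 < η) :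
    weightedMgf P X (coord i) s v ≤ ENNReal.ofReal η⁻¹ * mgfPos P X s (shift v η) := by
  have hX := h.aemeasurable_position hs
  have hm : AEMeasurable (fun ω => 1 * expDot (shift v η) (X s ω)) P :=
    (by fun_prop : Measurable fun y => 1 * expDot (shift v η) y).comp_aemeasurable hX
  unfold mgfPos weightedMgf
  rw [← lintegral_const_mul'' _ hm]
  refine lintegral_mono_ae ?_
  filter_upwards [h.position_nonneg_ae hs] with ω hω
  rw [one_mul, expDot_shift, mul_left_comm, mul_comm]
  gcongr
  rw [← ENNReal.ofReal_mul (by positivity)]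
  refine ofReal_le_ofReal ?_
  have h1 : X s ω i ≤ rate (X s ω) :=
    Finset.single_le_sum (fun j _ => hω j) (Finset.mem_univ i)
  have h2 := Real.add_one_le_exp (η * rate (X s ω))
  rw [inv_mul_eq_div, le_div_iff₀ hη]
  nlinarith

/-- The exponential never vanishes, so the hypothesis says that coordinate `i` is almost surely
zero, whatever the exponent. -/
lemma weightedMgf_coord_eq_zero (h : IsWalkWith P ν X ℱ Y W I A) {i : Fin c} {u : Fin c → ℝ}
    {s : ℝ} (hs : 0 ≤ s) (h0 : weightedMgf P X (coord i) s u = 0) (v : Fin c → ℝ) :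
    weightedMgf P X (coord i) s v = 0 := by
  have hX := h.aemeasurable_position hs
  have hm : AEMeasurable (fun ω => coord i (X s ω) * expDot u (X s ω)) P :=
    (by fun_prop : Measurable fun y => coord i y * expDot u y).comp_aemeasurable hX
  rw [weightedMgf, lintegral_eq_zero_iff' hm] at h0
  rw [weightedMgf, ← lintegral_zero (μ := P)]
  refine lintegral_congr_ae ?_
  filter_upwards [h0] with ω hω
  rw [(mul_eq_zero.mp hω).resolve_right (expDot_ne_zero _ _), zero_mul]

/-- If coordinate `i` can be positive at time `t` and the moment generating function is finite a
bit later on the characteristic line, then the generating function of row `i` is finite at some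
point of the line. -/
lemma exists_rowMgf_ne_top (h : IsWalkWith P ν X ℱ Y W I A) {i : Fin c} {v : Fin c → ℝ} {t δ : ℝ}
    (ht : 0 ≤ t) (hδ : 0 < δ) (hfin : mgfPos P X (t + δ) (shift v δ) ≠ ∞)
    (h0 : weightedMgf P X (coord i) t v ≠ 0) :
    ∃ x ∈ Ioo 0 δ, rowMgf ν i (shift v x) ≠ ∞ := by
  obtain ⟨C, G, -, hG, heq⟩ := h.mgfPos_shift_eq t v
  by_contra! hcon
  have htop : ∀ r ∈ Ioo t (t + δ), G r = ∞ := by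
    intro r hr
    rw [hG r (ht.trans hr.1.le), ENNReal.sum_eq_top]
    refine ⟨i, Finset.mem_univ i, ?_⟩
    rw [hcon (r - t) ⟨by linarith [hr.1], by linarith [hr.2]⟩]
    -- The coordinate weight stays nonzero at later times because it increases along the line, so
    -- the infinite factor makes the product infinite.
    refine ENNReal.mul_top (ne_of_gt ?_)
    exact (pos_iff_ne_zero.mpr h0).trans_le
      (h.weightedMgf_le_shift (measurable_coord i) v ht hr.1.le)
  have := heq (t + δ) (by linarith)
  rw [add_sub_cancel_left] at this
  refine hfin (this.trans (ENNReal.add_eq_top.mpr (Or.inr ?_)))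
  rw [eq_top_iff]
  calc (∞ : ℝ≥0∞) = ∫⁻ r in Ioo t (t + δ), ∞ := by
        rw [setLIntegral_const, Real.volume_Ioo, ENNReal.top_mul]
        simpa using hδ
    _ = ∫⁻ r in Ioo t (t + δ), G r :=
        setLIntegral_congr_fun measurableSet_Ioo fun r hr => (htop r hr).symm
    _ ≤ ∫⁻ r in Ioc 0 (t + δ), G r :=
        lintegral_mono_set fun r hr => ⟨ht.trans_lt hr.1, hr.2.le⟩

lemma toReal_mgfPos (h : IsWalkWith P ν X ℱ Y W I A) {s : ℝ} (hs : 0 ≤ s) (v : Fin c → ℝ) :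
    (mgfPos P X s v).toReal = phi P X s v := by
  have hX := h.aemeasurable_position hs
  rw [phi, integral_eq_lintegral_of_nonneg_ae (ae_of_all _ fun M => (Real.exp_pos _).le)]
  · simp only [mgfPos, weightedMgf, one_mul]
    rfl
  · exact ((by fun_prop : Measurable fun y : Fin c → ℝ =>
      Real.exp (∑ j, v j * y j)).comp_aemeasurable hX).aestronglyMeasurable

lemma integrable_exp (h : IsWalkWith P ν X ℱ Y W I A) {s : ℝ} (hs : 0 ≤ s) {v : Fin c → ℝ}
    (hfin : mgfPos P X s v ≠ ∞) : Integrable (fun ω => Real.exp (∑ j, v j * X s ω j)) P := by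
  have hX := h.aemeasurable_position hs
  refine (lintegral_ofReal_ne_top_iff_integrable ?_
    (ae_of_all _ fun M => (Real.exp_pos _).le)).mp ?_
  · exact ((by fun_prop : Measurable fun y : Fin c → ℝ =>
      Real.exp (∑ j, v j * y j)).comp_aemeasurable hX).aestronglyMeasurable
  · simpa only [mgfPos, weightedMgf, one_mul, expDot] using hfin

lemma coord_mul_expDot_ae_eq (h : IsWalkWith P ν X ℱ Y W I A) {s : ℝ} (hs : 0 ≤ s)
    (v : Fin c → ℝ) (i : Fin c) : (fun ω => coord i (X s ω) * expDot v (X s ω)) =ᵐ[P]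
      fun ω => ENNReal.ofReal (X s ω i * Real.exp (∑ j, v j * X s ω j)) := by
  filter_upwards [h.position_nonneg_ae hs] with ω hω
  rw [ENNReal.ofReal_mul (hω i)]
  rfl

lemma aestronglyMeasurable_mul_exp (h : IsWalkWith P ν X ℱ Y W I A) {s : ℝ} (hs : 0 ≤ s)
    (v : Fin c → ℝ) (i : Fin c) :
    AEStronglyMeasurable (fun ω => X s ω i * Real.exp (∑ j, v j * X s ω j)) P :=
  ((by fun_prop : Measurable fun y : Fin c → ℝ =>
    y i * Real.exp (∑ j, v j * y j)).comp_aemeasurable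
      (h.aemeasurable_position hs)).aestronglyMeasurable

lemma mul_exp_nonneg_ae (h : IsWalkWith P ν X ℱ Y W I A) {s : ℝ} (hs : 0 ≤ s)
    (v : Fin c → ℝ) (i : Fin c) :
    0 ≤ᵐ[P] fun ω => X s ω i * Real.exp (∑ j, v j * X s ω j) := by
  filter_upwards [h.position_nonneg_ae hs] with ω hω
  exact mul_nonneg (hω i) (Real.exp_pos _).le

lemma integrable_mul_exp (h : IsWalkWith P ν X ℱ Y W I A) {s : ℝ} (hs : 0 ≤ s) {v : Fin c → ℝ}
    {i : Fin c} (hfin : weightedMgf P X (coord i) s v ≠ ∞) :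
    Integrable (fun ω => X s ω i * Real.exp (∑ j, v j * X s ω j)) P := by
  refine (lintegral_ofReal_ne_top_iff_integrable (h.aestronglyMeasurable_mul_exp hs v i)
    (h.mul_exp_nonneg_ae hs v i)).mp ?_
  rwa [← lintegral_congr_ae (h.coord_mul_expDot_ae_eq hs v i)]

lemma integral_mul_exp (h : IsWalkWith P ν X ℱ Y W I A) {s : ℝ} (hs : 0 ≤ s) (v : Fin c → ℝ)
    (i : Fin c) : ∫ ω, X s ω i * Real.exp (∑ j, v j * X s ω j) ∂P =
      (weightedMgf P X (coord i) s v).toReal := by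
  rw [integral_eq_lintegral_of_nonneg_ae (h.mul_exp_nonneg_ae hs v i)
    (h.aestronglyMeasurable_mul_exp hs v i),
    ← lintegral_congr_ae (h.coord_mul_expDot_ae_eq hs v i), weightedMgf]

/-- The tangent inequality for the convex function `phi P X s`. -/
lemma sum_mul_le_phi_sub (h : IsWalkWith P ν X ℱ Y W I A) {s : ℝ} (hs : 0 ≤ s)
    {v w : Fin c → ℝ} (hv : mgfPos P X s v ≠ ∞) (hw : mgfPos P X s w ≠ ∞)
    (hvi : ∀ i, weightedMgf P X (coord i) s v ≠ ∞) :
    ∑ i, (w i - v i) * (weightedMgf P X (coord i) s v).toReal ≤ phi P X s w - phi P X s v := by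
  have hi := fun i => h.integrable_mul_exp hs (hvi i)
  simp only [← h.integral_mul_exp hs, ← integral_const_mul]
  rw [← integral_finsetSum _ fun i _ => (hi i).const_mul _, phi, phi,
    ← integral_sub (h.integrable_exp hs hw) (h.integrable_exp hs hv)]
  refine integral_mono (integrable_finsetSum _ fun i _ => (hi i).const_mul _)
    ((h.integrable_exp hs hw).sub (h.integrable_exp hs hv)) fun ω => ?_
  have e : ∑ i, (w i - v i) * (X s ω i * Real.exp (∑ j, v j * X s ω j)) =
      (∑ j, w j * X s ω j - ∑ j, v j * X s ω j) * Real.exp (∑ j, v j * X s ω j) := by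
    rw [← Finset.sum_sub_distrib, Finset.sum_mul]
    exact Finset.sum_congr rfl fun i _ => by ring
  simp only [e]
  have h1 := Real.add_one_le_exp (∑ j, w j * X s ω j - ∑ j, v j * X s ω j)
  rw [Real.exp_sub, le_div_iff₀ (Real.exp_pos _)] at h1
  linarith

end IsWalkWith
end PolyaWalk

end

/-! ### Derivatives of the moment generating function and the differential equation. -/

noncomputable section

namespace PolyaWalk

open Set ENNReal

lemma dist_shift_lt {c : ℕ} {u v : Fin c → ℝ} {a x ε : ℝ} (hv : dist v u < a)
    (hx : a + |x| ≤ ε) : dist (shift v x) u < ε := by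
  have ha : 0 < a := dist_nonneg.trans_lt hv
  have hε : 0 < ε := by linarith [abs_nonneg x]
  rw [dist_pi_lt_iff ha] at hv
  rw [dist_pi_lt_iff hε]
  intro j
  have := hv j
  rw [Real.dist_eq] at this ⊢
  calc |shift v x j - u j| = |(v j - u j) + x| := by simp only [shift]; ring_nf
    _ ≤ |v j - u j| + |x| := abs_add_le _ _
    _ < ε := by linarith

variable {Ω : Type*} [mΩ : MeasurableSpace Ω] {P : Measure Ω} {c : ℕ}
  {ν : Measure (Fin c → Fin c → ℝ)} {X : ℝ → Ω → Fin c → ℝ}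
  {ℱ : Filtration ℕ mΩ} {Y : ℕ → Ω → Fin c → ℝ} {W : ℕ → Ω → ℝ} {I : ℕ → Ω → Fin c}
  {A : ℕ → Ω → Fin c → Fin c → ℝ}

namespace IsWalkWith

variable [IsProbabilityMeasure P] [IsProbabilityMeasure ν]
  {t ε : ℝ} {u : Fin c → ℝ}

lemma weightedMgf_coord_ne_top (h : IsWalkWith P ν X ℱ Y W I A) (hε : 0 < ε)
    (hfin : ∀ s v, 0 ≤ s → |s - t| < ε → dist v u < ε → mgfPos P X s v ≠ ∞)
    (i : Fin c) (s : ℝ) (v : Fin c → ℝ) (hs : 0 ≤ s) (hst : |s - t| < ε / 2)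
    (hv : dist v u < ε / 2) : weightedMgf P X (coord i) s v ≠ ∞ := by
  refine ne_top_of_le_ne_top ?_ (h.weightedMgf_coord_le i v hs (half_pos hε))
  refine ENNReal.mul_ne_top ofReal_ne_top (hfin _ _ hs (by linarith) (dist_shift_lt hv ?_))
  rw [abs_of_pos (half_pos hε)]
  linarith

/-- `exists_rowMgf_ne_top` gives finiteness only at some unspecified point of a window. One window
on each side of `u` suffices, since finiteness interpolates between them. -/
lemma rowMgf_shift_ne_top (h : IsWalkWith P ν X ℱ Y W I A) (ht : 0 ≤ t) (hε : 0 < ε)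
    (hfin : ∀ s v, 0 ≤ s → |s - t| < ε → dist v u < ε → mgfPos P X s v ≠ ∞)
    {i : Fin c} {r : ℝ} (hr : t ≤ r) (hr' : r < t + ε / 4)
    (h0 : weightedMgf P X (coord i) r u ≠ 0) {x : ℝ} (hx : |x| ≤ ε / 8) :
    rowMgf ν i (shift u x) ≠ ∞ := by
  have key : ∀ a : ℝ, |a| < ε / 2 → ∃ x ∈ Ioo a (a + ε / 4), rowMgf ν i (shift u x) ≠ ∞ := by
    intro a ha
    have hne : weightedMgf P X (coord i) r (shift u a) ≠ 0 := fun hz =>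
      h0 (h.weightedMgf_coord_eq_zero (ht.trans hr) hz u)
    obtain ⟨x, hx, hfx⟩ := h.exists_rowMgf_ne_top (ht.trans hr) (δ := ε / 4) (by linarith)
      (by
        refine hfin _ _ (by linarith) (by rw [abs_lt]; constructor <;> linarith) ?_
        rw [shift_shift]
        refine dist_shift_lt (a := ε / 8) (by simpa using hε) ?_
        have := abs_add_le a (ε / 4)
        rw [abs_of_pos (by linarith : 0 < ε / 4)] at this
        linarith) hne
    rw [shift_shift] at hfx
    exact ⟨a + x, ⟨by linarith [hx.1], by linarith [hx.2]⟩, hfx⟩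
  -- The windows have length `ε / 4` and are `(-3ε/8, -ε/8)` and `(ε/8, 3ε/8)`, hence enclose
  -- `[-ε/8, ε/8]`.
  obtain ⟨x₁, hx₁, h₁⟩ := key (-(3 * ε / 8)) (by rw [abs_neg, abs_of_pos] <;> linarith)
  obtain ⟨x₂, hx₂, h₂⟩ := key (ε / 8) (by rw [abs_of_pos] <;> linarith)
  rw [abs_le] at hx
  exact rowMgf_ne_top_of_le (by linarith [hx₁.2]) (by linarith [hx₂.1]) h₁ h₂

/-- Each term of the integrand in the Duhamel formula is finite and continuous in time. -/
lemma tendsto_coord_mul_rowMgf (h : IsWalkWith P ν X ℱ Y W I A) (ht : 0 ≤ t) (hε : 0 < ε)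
    (hfin : ∀ s v, 0 ≤ s → |s - t| < ε → dist v u < ε → mgfPos P X s v ≠ ∞) (i : Fin c) :
    weightedMgf P X (coord i) t u * rowMgf ν i u ≠ ∞ ∧
    Tendsto (fun r => weightedMgf P X (coord i) r (shift u (r - t)) *
      rowMgf ν i (shift u (r - t))) (𝓝[Ici 0] t)
      (𝓝 (weightedMgf P X (coord i) t u * rowMgf ν i u)) := by
  -- Either coordinate `i` is charged at some time in `[t, t + ε/4)`, which makes the row function
  -- finite near `u`, or its weight vanishes up to `t + ε/4` and the product is zero even against an
  -- infinite row function. Looking past `t` covers a coordinate that is zero at `t` and charged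
  -- just afterwards.
  by_cases hex : ∃ r, t ≤ r ∧ r < t + ε / 4 ∧ weightedMgf P X (coord i) r u ≠ 0
  · obtain ⟨r, hr, hr', h0⟩ := hex
    have hrow : ∀ x, |x| ≤ ε / 8 → rowMgf ν i (shift u x) ≠ ∞ := fun x hx =>
      h.rowMgf_shift_ne_top ht hε hfin hr hr' h0 hx
    have hrow0 : rowMgf ν i u ≠ ∞ := by
      simpa using hrow 0 (by rw [abs_zero]; linarith)
    have hc := h.weightedMgf_coord_ne_top hε hfin i
    have hct := hc t u ht (by simpa using hε) (by simpa using hε)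
    refine ⟨ENNReal.mul_ne_top hct hrow0,
      ENNReal.Tendsto.mul ?_ (Or.inr hrow0) ?_ (Or.inr hct)⟩
    · refine h.tendsto_weightedMgf_shift (measurable_coord i) ht (b := t + ε / 4) (by linarith) ?_
      refine hc _ _ (by linarith) ?_ (dist_shift_lt (a := ε / 8) (by simpa using hε) ?_)
      all_goals
        rw [add_sub_cancel_left, abs_of_pos] <;> linarith
    · have h8 : 0 < ε / 8 := by linarith
      have := tendsto_rowMgf_shift (ν := ν) (i := i) (u := u) h8
        (hrow _ (by rw [abs_neg, abs_of_pos h8])) (hrow _ (by rw [abs_of_pos h8]))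
      refine this.comp ?_
      have hc : Tendsto (fun r : ℝ => r - t) (𝓝 t) (𝓝 (t - t)) := by
        exact (continuous_id.sub continuous_const).tendsto t
      rw [sub_self] at hc
      exact hc.mono_left nhdsWithin_le_nhds
  · push Not at hex
    have hzero : ∀ r v, 0 ≤ r → r < t + ε / 4 → weightedMgf P X (coord i) r v = 0 := by
      intro r v hr hr'
      rcases le_total t r with htr | hrt
      · exact h.weightedMgf_coord_eq_zero hr (hex r htr hr') v
      · have h1 := h.weightedMgf_coord_eq_zero ht (hex t le_rfl (by linarith)) (shift v (t - r))
        exact le_antisymm (h1 ▸ h.weightedMgf_le_shift (measurable_coord i) v hr hrt) zero_le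
    rw [hzero t u ht (by linarith), zero_mul]
    refine ⟨ENNReal.zero_ne_top, tendsto_const_nhds.congr' ?_⟩
    filter_upwards [self_mem_nhdsWithin, mem_nhdsWithin_of_mem_nhds
      (Iio_mem_nhds (by linarith : t < t + ε / 4))] with r hr hr'
    rw [hzero r _ hr hr', zero_mul]

/-- Derivative of the moment generating function along the characteristic line. -/
lemma hasDerivWithinAt_phi_shift (h : IsWalkWith P ν X ℱ Y W I A) (ht : 0 ≤ t) (hε : 0 < ε)
    (hfin : ∀ s v, 0 ≤ s → |s - t| < ε → dist v u < ε → mgfPos P X s v ≠ ∞) :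
    HasDerivWithinAt (fun s => phi P X s (shift u (s - t)))
      (∑ i, (weightedMgf P X (coord i) t u).toReal * psi ν i u) (Ici 0) t := by
  obtain ⟨C, G, hmeas, hG, heq⟩ := h.mgfPos_shift_eq t u
  set b := t + ε / 2 with hb
  have htb : t < b := by linarith
  have hb0 : 0 < b := by linarith
  have hbfin : C ≠ ∞ ∧ ∫⁻ r in Ioc 0 b, G r ≠ ∞ := by
    rw [← ENNReal.add_ne_top, ← heq b hb0.le]
    refine hfin _ _ hb0.le ?_ (dist_shift_lt (a := ε / 4) (by simpa using hε) ?_)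
    all_goals
      rw [hb, add_sub_cancel_left, abs_of_pos] <;> linarith
  have hterm := h.tendsto_coord_mul_rowMgf ht hε hfin
  have hGt : G t = ∑ i, weightedMgf P X (coord i) t u * rowMgf ν i u := by
    simpa using hG t ht
  have hGlim : Tendsto G (𝓝[Ici 0] t) (𝓝 (G t)) := by
    rw [hGt]
    refine (tendsto_finsetSum _ fun i _ => (hterm i).2).congr' ?_
    filter_upwards [self_mem_nhdsWithin] with r hr
    exact (hG r hr).symm
  have hGfin : G t ≠ ∞ := by
    rw [hGt]
    exact ENNReal.sum_ne_top.mpr fun i _ => (hterm i).1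
  -- Where `rowMgf` is infinite, finiteness of the product forces the weight to be zero, so the
  -- default value of `psi` is harmless.
  have hval : (G t).toReal = ∑ i, (weightedMgf P X (coord i) t u).toReal * psi ν i u := by
    rw [hGt, ENNReal.toReal_sum fun i _ => (hterm i).1]
    simp only [ENNReal.toReal_mul, toReal_rowMgf]
  have hphi : ∀ s ∈ Icc 0 b, phi P X s (shift u (s - t)) =
      C.toReal + ∫ r in (0 : ℝ)..s, (G r).toReal := by
    intro s hs
    have hsfin : ∫⁻ r in Ioc 0 s, G r ≠ ∞ :=
      ne_top_of_le_ne_top hbfin.2 (lintegral_mono_set (Ioc_subset_Ioc_right hs.2))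
    rw [← h.toReal_mgfPos hs.1, heq s hs.1, ENNReal.toReal_add hbfin.1 hsfin,
      intervalIntegral.integral_of_le hs.1,
      integral_toReal (hmeas s) (ae_lt_top' (hmeas s) hsfin)]
  have hint : IntegrableOn (fun r => (G r).toReal) (Ioc 0 b) :=
    integrable_toReal_of_lintegral_ne_top (hmeas b) hbfin.2
  have hIcc : 𝓝[Icc 0 b] t = 𝓝[Ici 0] t := by
    rw [← Ici_inter_Iic]
    exact nhdsWithin_inter_of_mem' (mem_nhdsWithin_of_mem_nhds (Iic_mem_nhds htb))
  -- Working within `Icc 0 b` lets one form of the fundamental theorem cover `t = 0` and `t > 0`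
  -- alike.
  have : Fact (t ∈ Icc 0 b) := ⟨⟨ht, htb.le⟩⟩
  have hderiv : HasDerivWithinAt (fun s => ∫ r in (0 : ℝ)..s, (G r).toReal) (G t).toReal
      (Icc 0 b) t := by
    refine intervalIntegral.integral_hasDerivWithinAt_right (t := Icc 0 b) ?_ ?_ ?_
    · rw [intervalIntegrable_iff_integrableOn_Ioc_of_le ht]
      exact hint.mono_set (Ioc_subset_Ioc_right htb.le)
    · refine ⟨Icc 0 b, self_mem_nhdsWithin, ?_⟩
      rw [← restrict_Ioc_eq_restrict_Icc]
      exact hint.aestronglyMeasurable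
    · rw [ContinuousWithinAt, hIcc]
      exact (ENNReal.tendsto_toReal hGfin).comp hGlim
  have h1 : HasDerivWithinAt (fun s => phi P X s (shift u (s - t))) (G t).toReal (Icc 0 b) t :=
    (hderiv.const_add C.toReal).congr hphi (hphi t ⟨ht, htb.le⟩)
  rw [hval] at h1
  exact h1.mono_of_mem_nhdsWithin (hIcc ▸ self_mem_nhdsWithin)

lemma tendsto_toReal_coord (h : IsWalkWith P ν X ℱ Y W I A) (ht : 0 ≤ t) (hε : 0 < ε)
    (hfin : ∀ s v, 0 ≤ s → |s - t| < ε → dist v u < ε → mgfPos P X s v ≠ ∞) (i : Fin c) :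
    Tendsto (fun p : ℝ × (Fin c → ℝ) => (weightedMgf P X (coord i) p.1 p.2).toReal)
      (𝓝[Ici 0 ×ˢ univ] (t, u)) (𝓝 (weightedMgf P X (coord i) t u).toReal) :=
  (ENNReal.tendsto_toReal (h.weightedMgf_coord_ne_top hε hfin i t u ht (by simpa using hε)
    (by simpa using hε))).comp (h.tendsto_weightedMgf (measurable_coord i) ht (half_pos hε)
    (h.weightedMgf_coord_ne_top hε hfin i))

/-- Partial derivatives of the moment generating function in the space variable. -/
lemma hasDerivAt_phi_update (h : IsWalkWith P ν X ℱ Y W I A) (ht : 0 ≤ t) (hε : 0 < ε)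
    (hfin : ∀ s v, 0 ≤ s → |s - t| < ε → dist v u < ε → mgfPos P X s v ≠ ∞) (i : Fin c) :
    HasDerivAt (fun x => phi P X t (Function.update u i x))
      (weightedMgf P X (coord i) t u).toReal (u i) := by
  have hcont : Tendsto (fun x => Function.update u i x) (𝓝 (u i)) (𝓝 u) := by
    have : Continuous fun x => Function.update u i x := continuous_const.update i continuous_id
    simpa using this.tendsto (u i)
  have hnear : ∀ᶠ x in 𝓝 (u i), dist (Function.update u i x) u < ε / 2 :=
    (hcont.eventually (Metric.ball_mem_nhds u (half_pos hε)))
  have hmgf : ∀ v, dist v u < ε / 2 → mgfPos P X t v ≠ ∞ := fun v hv =>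
    hfin t v ht (by simpa using hε) (by linarith)
  have hu : dist u u < ε / 2 := by simpa using hε
  have hcoord : ∀ v, dist v u < ε / 2 → ∀ j, weightedMgf P X (coord j) t v ≠ ∞ := fun v hv j =>
    h.weightedMgf_coord_ne_top hε hfin j t v ht (by simpa using hε) hv
  have hsum : ∀ (x : ℝ) (a : Fin c → ℝ),
      ∑ j, (Function.update u i x j - u j) * a j = (x - u i) * a i := by
    intro x a
    rw [Finset.sum_eq_single i]
    · simp
    · intro j _ hj
      simp [hj]
    · simp
  rw [← hasDerivWithinAt_univ]
  -- The tangent at `u` bounds the increment from below, the tangent at the moved point from above;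
  -- the two slopes merge by continuity.
  refine hasDerivWithinAt_of_le_of_le (a := fun _ => (weightedMgf P X (coord i) t u).toReal)
    (b := fun x => (weightedMgf P X (coord i) t (Function.update u i x)).toReal)
    tendsto_const_nhds ?_ ?_ ?_
  · rw [nhdsWithin_univ]
    refine (h.tendsto_toReal_coord ht hε hfin i).comp (f := fun x => (t, Function.update u i x)) ?_
    exact tendsto_nhdsWithin_iff.mpr ⟨tendsto_const_nhds.prodMk_nhds hcont,
      Eventually.of_forall fun x => ⟨ht, mem_univ _⟩⟩
  · rw [nhdsWithin_univ]
    filter_upwards [hnear] with x hx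
    have := h.sum_mul_le_phi_sub ht (hmgf u hu) (hmgf _ hx) (hcoord u hu)
    rw [hsum x fun j => (weightedMgf P X (coord j) t u).toReal] at this
    rwa [Function.update_eq_self]
  · rw [nhdsWithin_univ]
    filter_upwards [hnear] with x hx
    have h1 := h.sum_mul_le_phi_sub ht (hmgf _ hx) (hmgf u hu) (hcoord _ hx)
    have h2 := hsum x fun j => (weightedMgf P X (coord j) t (Function.update u i x)).toReal
    have h3 : ∑ j, (u j - Function.update u i x j) *
        (weightedMgf P X (coord j) t (Function.update u i x)).toReal =
        -∑ j, (Function.update u i x j - u j) *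
          (weightedMgf P X (coord j) t (Function.update u i x)).toReal := by
      rw [← Finset.sum_neg_distrib]
      exact Finset.sum_congr rfl fun j _ => by ring
    rw [Function.update_eq_self]
    linarith

/-- Contribution of the diagonal translation to the derivative along the characteristic line. -/
lemma hasDerivWithinAt_phi_shift_sub (h : IsWalkWith P ν X ℱ Y W I A) (ht : 0 ≤ t) (hε : 0 < ε)
    (hfin : ∀ s v, 0 ≤ s → |s - t| < ε → dist v u < ε → mgfPos P X s v ≠ ∞) :
    HasDerivWithinAt (fun s => phi P X s (shift u (s - t)) - phi P X s u)
      (∑ i, (weightedMgf P X (coord i) t u).toReal) (Ici 0) t := by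
  have hfst : Tendsto (fun s : ℝ => s) (𝓝[Ici 0] t) (𝓝 t) := nhdsWithin_le_nhds
  have hshift : Tendsto (fun s => shift u (s - t)) (𝓝[Ici 0] t) (𝓝 u) := by
    have : Continuous fun s => shift u (s - t) := by unfold shift; fun_prop
    simpa using (this.tendsto t).mono_left nhdsWithin_le_nhds
  have hlim : ∀ v : ℝ → Fin c → ℝ, Tendsto v (𝓝[Ici 0] t) (𝓝 u) →
      Tendsto (fun s => ∑ i, (weightedMgf P X (coord i) s (v s)).toReal) (𝓝[Ici 0] t)
      (𝓝 (∑ i, (weightedMgf P X (coord i) t u).toReal)) := by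
    intro v hv
    refine tendsto_finsetSum _ fun i _ => ?_
    refine (h.tendsto_toReal_coord ht hε hfin i).comp (f := fun s => (s, v s)) ?_
    exact tendsto_nhdsWithin_iff.mpr ⟨hfst.prodMk_nhds hv,
      eventually_nhdsWithin_of_forall fun s hs => ⟨hs, mem_univ _⟩⟩
  have hnear : ∀ᶠ s in 𝓝[Ici 0] t, 0 ≤ s ∧ |s - t| < ε / 2 ∧ dist (shift u (s - t)) u < ε / 2 := by
    filter_upwards [self_mem_nhdsWithin, hfst.eventually (Metric.ball_mem_nhds t (half_pos hε)),
      hshift.eventually (Metric.ball_mem_nhds u (half_pos hε))] with s h1 h2 h3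
    exact ⟨h1, h2, h3⟩
  have hu : dist u u < ε / 2 := by simpa using hε
  have hmgf : ∀ s v, 0 ≤ s → |s - t| < ε / 2 → dist v u < ε / 2 → mgfPos P X s v ≠ ∞ :=
    fun s v hs hst hv => hfin s v hs (by linarith) (by linarith)
  have hcoord := h.weightedMgf_coord_ne_top hε hfin
  -- The base time `s` moves too, so the tangent inequalities are used at time `s`, and joint
  -- continuity of the coordinate weights gives the limit of both slopes.
  refine hasDerivWithinAt_of_le_of_le (hlim (fun _ => u) tendsto_const_nhds) (hlim _ hshift) ?_ ?_
  · filter_upwards [hnear] with s hs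
    have := h.sum_mul_le_phi_sub hs.1 (hmgf s u hs.1 hs.2.1 hu) (hmgf s _ hs.1 hs.2.1 hs.2.2)
      (fun i => hcoord i s u hs.1 hs.2.1 hu)
    simpa [shift, Finset.mul_sum] using this
  · filter_upwards [hnear] with s hs
    have := h.sum_mul_le_phi_sub hs.1 (hmgf s _ hs.1 hs.2.1 hs.2.2) (hmgf s u hs.1 hs.2.1 hu)
      (fun i => hcoord i s _ hs.1 hs.2.1 hs.2.2)
    have e : ∀ j, u j - shift u (s - t) j = -(s - t) := fun j => by simp only [shift]; ring
    simp only [e, ← Finset.mul_sum] at this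
    simp only [sub_self, shift_zero]
    linarith

end IsWalkWith
end PolyaWalk
end

theorem theorem1 {Ω : Type*} [MeasurableSpace Ω] (P : Measure Ω) [IsProbabilityMeasure P]
    {c : ℕ} (ν : Measure (Fin c → Fin c → ℝ)) [IsProbabilityMeasure ν]
    (X : ℝ → Ω → Fin c → ℝ) (hX : PolyaWalk.IsWalk P ν X)
    (t : ℝ) (ht : 0 ≤ t) (u : Fin c → ℝ)
    (hfin : ∀ᶠ p : ℝ × (Fin c → ℝ) in 𝓝[Set.Ici (0 : ℝ) ×ˢ Set.univ] (t, u),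
      Integrable (fun ω => Real.exp (∑ j, p.2 j * X p.1 ω j)) P) :
    ∃ (φt : ℝ) (φu : Fin c → ℝ),
      HasDerivWithinAt (fun s => PolyaWalk.phi P X s u) φt (Set.Ici 0) t ∧
      (∀ i, HasDerivAt (fun x => PolyaWalk.phi P X t (Function.update u i x)) (φu i) (u i)) ∧
      (∀ i, φu i ≠ 0 → Integrable
        (fun M : Fin c → Fin c → ℝ => Real.exp (∑ j, u j * M i j)) ν) ∧
      φt + ∑ i, (1 - PolyaWalk.psi ν i u) * φu i = 0 := by
  obtain ⟨ℱ, Y, W, I, A, h⟩ := hX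
  rw [eventually_nhdsWithin_iff, Metric.eventually_nhds_iff] at hfin
  obtain ⟨ε, hε, hball⟩ := hfin
  have hmgf : ∀ s v, 0 ≤ s → |s - t| < ε → dist v u < ε → PolyaWalk.mgfPos P X s v ≠ ⊤ := by
    intro s v hs hst hv
    have hint := hball (y := (s, v)) (by
      rw [Prod.dist_eq]
      exact max_lt hst hv) ⟨hs, Set.mem_univ _⟩
    have := (lintegral_ofReal_ne_top_iff_integrable hint.aestronglyMeasurable
      (ae_of_all _ fun ω => (Real.exp_pos _).le)).mpr hint
    simpa only [PolyaWalk.mgfPos, PolyaWalk.weightedMgf, PolyaWalk.expDot, one_mul] using this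
  -- The time derivative is found by writing `φ(s, u)` as its value on the characteristic line minus
  -- the diagonal increment.
  refine ⟨_, fun i => (PolyaWalk.weightedMgf P X (PolyaWalk.coord i) t u).toReal,
    ((h.hasDerivWithinAt_phi_shift ht hε hmgf).sub
      (h.hasDerivWithinAt_phi_shift_sub ht hε hmgf)).congr (fun s _ => by simp) (by simp),
    h.hasDerivAt_phi_update ht hε hmgf, fun i hi => ?_, ?_⟩
  · have h0 : PolyaWalk.weightedMgf P X (PolyaWalk.coord i) t u ≠ 0 := fun hz => hi (by simp [hz])
    have := h.rowMgf_shift_ne_top ht hε hmgf le_rfl (by linarith) h0 (x := 0)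
      (by rw [abs_zero]; linarith)
    rw [PolyaWalk.shift_zero] at this
    exact PolyaWalk.integrable_of_rowMgf_ne_top this
  · rw [← Finset.sum_sub_distrib, ← Finset.sum_add_distrib]
    exact Finset.sum_eq_zero fun i _ => by ring
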